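/- **Theorem 2.5.** There is a universal constant $C>0$ such that the following holds. Let $\mathcal X$ be a measurable space, $n\ge 1$ an integer, $[n]=\{1,\dots,n\}$, and $f:\mathcal X^n\to\mathbb R$ a measurable map. *Definitions.* A graphical rule on $\mathcal X^m$ is a map $G$ that assigns to every $x\in\mathcal X^m$ an undirected (simple) graph $G(x)$ on $[m]$. It is *symmetric* if for every permutation $\pi$ of $[m]$, every $x\in\mathcal X^m$ and all $i,j\in[m]$: $\{i,j\}$ is an edge of $G(x_{\pi(1)},\dots,x_{\pi(m)})$ if and only if $\{\pi(i),\pi(j)\}$ is an edge of $G(x_1,\dots,x_m)$. For $m>n$, a graphical rule $G'$ on $\mathcal X^m$ is an *extension* of a graphical rule $G$ on $\mathcal X^n$ if, whenever $x\in\mathcal X^n$, $y\in\mathcal X^m$ and distinct $i_1,\dots,i_n\in[m]$ satisfy $x_k=y_{i_k}$ for all $k$, the graph $G(x)$ is the induced subgraph of $G'(y)$ on $i_1,\dots,i_n$, i.e. for all $k,l\in[n]$, $\{k,l\}$ is an edge of $G(x)$ if and only if $\{i_k,i_l\}$ is an edge of $G'(y)$. For $x,x'\in\mathcal X^n$ and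 distinct $i,j\in[n]$, let $x^i$ be $x$ with $x_i$ replaced by $x'_i$, and $x^{ij}$ be $x$ with $x_i,x_j$ replaced by $x'_i,x'_j$. A graphical rule $G$ on $\mathcal X^n$ is an *interaction rule* for $f$ if for all $x,x'\in\mathcal X^n$ and all distinct $i,j\in[n]$ such that $\{i,j\}$ is not an edge in any of $G(x),G(x^i),G(x^j),G(x^{ij})$, one has $f(x)-f(x^j)=f(x^i)-f(x^{ij})$. *Assumptions.* Suppose $f$ has a symmetric interaction rule $G$, and let $G'$ be a symmetric extension of $G$ to $\mathcal X^{n+4}$ such that for all $i,j\in[n+4]$ the set $\{y\in\mathcal X^{n+4}: \{i,j\}\text{ is an edge of }G'(y)\}$ is measurable. Let $X_1,X_2,\dots$ be i.i.d. $\mathcal X$-valued random variables, $X=(X_1,\dots,X_n)$, and let $X'=(X_1',\dots,X_n')$ be an independent copy of $X$. Let $W=f(X)$ and assume $\mathbb E(W^2)<\infty$ and $\sigma^2:=\operatorname{Var}(W)>0$, where $\sigma>0$. For each $j\in[n]$ put $$\Delta_jf(X)=W-f(X_1,\dots,X_{j-1},X_j',X_{j+1},\dots,X_n),\qquad M=\max_{j}|\Delta_jf(X)|,$$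 and let $\delta=1+{}$the degree of the vertex $1$ in $G'(X_1,\dots,X_{n+4})$. *Conclusion.* $$\delta_W\le\frac{C\,n^{1/2}}{\sigma^2}\,\mathbb E(M^8)^{1/4}\,\mathbb E(\delta^4)^{1/4}+\frac1{2\sigma^3}\sum_{j=1}^n\mathbb E|\Delta_jf(X)|^3,$$ where the right-hand side may be $+\infty$, and $\delta_W$ is the Kantorovich–Wasserstein distance between the law $\mu$ of $(W-\mathbb E W)/\sigma$ and the standard Gaussian law $\nu$, i.e. $\delta_W=\sup\left|\int h\,d\mu-\int h\,d\nu\right|$ over all $h:\mathbb R\to\mathbb R$ with $|h(s)-h(t)|\le|s-t|$ for all $s,t$. -/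

import Mathlib

open MeasureTheory ProbabilityTheory
open scoped ENNReal

namespace NormalApprox

/-- A graphical rule on `𝒳ⁿ`: an undirected graph on `n` vertices for every point of `𝒳ⁿ`. -/
abbrev GraphicalRule (𝒳 : Type*) (n : ℕ) := (Fin n → 𝒳) → SimpleGraph (Fin n)

namespace GraphicalRule

variable {𝒳 : Type*} {n m : ℕ}

/-- The graph depends on the labelling of the coordinates in an equivariant way: `{i, j}` is an
edge of `G (x_{π 1}, …, x_{π n})` iff `{π i, π j}` is an edge of `G (x_1, …, x_n)`. -/
def IsSymmetric (G : GraphicalRule 𝒳 n) : Prop :=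
  ∀ (π : Equiv.Perm (Fin n)) (x : Fin n → 𝒳) (i j : Fin n),
    (G (x ∘ π)).Adj i j ↔ (G x).Adj (π i) (π j)

/-- `G'` extends `G`: whenever `x_k = y_{e k}` for all `k`, with distinct indices `e k`, the graph
`G x` is the subgraph of `G' y` induced on these indices. -/
def IsExtension (G' : GraphicalRule 𝒳 m) (G : GraphicalRule 𝒳 n) : Prop :=
  ∀ (e : Fin n ↪ Fin m) (x : Fin n → 𝒳) (y : Fin m → 𝒳), (∀ k, x k = y (e k)) →
    ∀ i j : Fin n, (G x).Adj i j ↔ (G' y).Adj (e i) (e j)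

end GraphicalRule

/-- The vector `x` with its `i`-th coordinate replaced by that of `x'`. -/
def replace {𝒳 : Type*} {n : ℕ} (x x' : Fin n → 𝒳) (i : Fin n) : Fin n → 𝒳 :=
  Function.update x i (x' i)

/-- The coordinates `i` and `j` are noninteracting under the triple `(f, x, x')`. -/
def Noninteracting {𝒳 : Type*} {n : ℕ} (f : (Fin n → 𝒳) → ℝ) (x x' : Fin n → 𝒳)
    (i j : Fin n) : Prop :=
  f x - f (replace x x' j) = f (replace x x' i) - f (replace (replace x x' i) x' j)

/-- If two distinct vertices `i`, `j` are not joined in `G x`, `G xⁱ`, `G xʲ` and `G xⁱʲ`, then the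
coordinates `i` and `j` are noninteracting under `(f, x, x')`. -/
def GraphicalRule.IsInteractionRule {𝒳 : Type*} {n : ℕ} (G : GraphicalRule 𝒳 n)
    (f : (Fin n → 𝒳) → ℝ) : Prop :=
  ∀ (x x' : Fin n → 𝒳) (i j : Fin n), i ≠ j →
    ¬ (G x).Adj i j →
    ¬ (G (replace x x' i)).Adj i j →
    ¬ (G (replace x x' j)).Adj i j →
    ¬ (G (replace (replace x x' i) x' j)).Adj i j →
    Noninteracting f x x' i j

/-- The randomized derivative `Δ_j f = f(x) - f(xʲ)` along the `j`-th coordinate. -/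
def delta {𝒳 : Type*} {n : ℕ} (f : (Fin n → 𝒳) → ℝ) (x x' : Fin n → 𝒳) (j : Fin n) : ℝ :=
  f x - f (replace x x' j)

/-- The Kantorovich–Wasserstein distance of two measures on the line (with finite first moment),
as a supremum over all Lipschitz functions with constant `1`. -/
noncomputable def wasserstein (μ ν : Measure ℝ) : ℝ≥0∞ :=
  ⨆ (h : ℝ → ℝ) (_ : LipschitzWith 1 h), ENNReal.ofReal |∫ t, h t ∂μ - ∫ t, h t ∂ν|

/-- The distance to normality of a random variable `W` with finite, nonzero variance: the distance
between the law of `(W - E W) / √Var W` and the standard Gaussian law. -/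
noncomputable def distToNormal {Ω : Type*} [MeasurableSpace Ω] (P : Measure Ω) (W : Ω → ℝ) :
    ℝ≥0∞ :=
  wasserstein (P.map fun ω => (W ω - ∫ ω', W ω' ∂P) / √(variance W P)) (gaussianReal 0 1)

open Classical in
/-- One plus the degree of the vertex `v` in the graph `H`. -/
noncomputable def onePlusDegree {n : ℕ} (H : SimpleGraph (Fin n)) (v : Fin n) : ℕ :=
  1 + H.degree v

end NormalApprox

/-! The argument is Stein's method driven by a covariance identity for functions of independent
variables. Let f be centred with variance 1, W = f(X), and let φ solve Stein's equation for a
1-Lipschitz h. Then E h(W) minus the Gaussian mean of h equals E φ'(W) − E φ(W) W, where |φ'| ≤ 7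
and φ' is 2-Lipschitz (`exists_stein_solution`).

Write X^A for X with the coordinates in A replaced by those of X'. Telescoping E g(X) f(X^A) along a
random chain of sets from ∅ to [n], and antisymmetrizing each step by swapping X_j with X'_j, gives
Cov(g, f) = ½ Σ_A `weight A` Σ_{j∉A} E Δ_j g(X) Δ_j f(X^A)
(`integral_mul_sub_integral_mul_integral`). For g = φ ∘ f, replacing Δ_j g by φ'(W) Δ_j f costs at
most |Δ_j f|², which produces the third moment term. What is left is governed by the fluctuations of
E[T_A | X], where T_A = Σ_{j∉A} Δ_j f(X) Δ_j f(X^A), because ½ Σ_A `weight A` E T_A = Var W = 1.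

These fluctuations are bounded by the Efron–Stein inequality. If the i-th coordinate of X is
resampled, the j-th summand of T_A can change only when j = i or when i and j are joined in one of
the graphs seen by the derivatives (`enorm_prodSum_sub_le`). Cauchy–Schwarz separates E M⁸ from the
fourth moment of a count of neighbours of i outside A. Through its first moment and fourth factorial
moment that count is compared with δ (`mul_lintegral_neighborCount_le`). The fourth factorial moment
involves four different replaced coordinates, hence n + 4 variables; this is where the extension G'
enters.

The comparison gains a factor |Aᶜ|/n, so the standard deviation of E[T_A | X] is of order (n
|Aᶜ|)^{1/4} (E M⁸ E δ⁴)^{1/4}. The weighted sum over A is then of order √n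
(`sum_weight_mul_sqrt_sqrt_le`). -/

namespace NormalApprox

/-! ### Stein's equation for the standard Gaussian law -/

section Stein

open Set Filter Topology

lemma gaussianPDFReal_std (x : ℝ) :
    gaussianPDFReal 0 1 x = (√(2 * Real.pi))⁻¹ * Real.exp (-x ^ 2 / 2) := by
  simp [gaussianPDFReal]

lemma gaussianPDFReal_std_le_one (x : ℝ) : gaussianPDFReal 0 1 x ≤ 1 := by
  rw [gaussianPDFReal_std]
  have h1 : (√(2 * Real.pi))⁻¹ ≤ 1 := by
    apply inv_le_one_of_one_le₀
    rw [Real.one_le_sqrt]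
    linarith [Real.pi_gt_three]
  have h2 : Real.exp (-x ^ 2 / 2) ≤ 1 := by
    rw [Real.exp_le_one_iff]
    nlinarith [sq_nonneg x]
  exact mul_le_one₀ h1 (Real.exp_pos _).le h2

lemma hasDerivAt_gaussianPDFReal_std (x : ℝ) :
    HasDerivAt (gaussianPDFReal 0 1) (-x * gaussianPDFReal 0 1 x) x := by
  have h : HasDerivAt (fun x : ℝ => (√(2 * Real.pi))⁻¹ * Real.exp (-x ^ 2 / 2))
      ((√(2 * Real.pi))⁻¹ * (Real.exp (-x ^ 2 / 2) * (-(2 * x) / 2))) x := by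
    refine HasDerivAt.const_mul _ (HasDerivAt.exp ?_)
    have := ((hasDerivAt_pow 2 x).neg).div_const 2
    simpa using this
  have e : gaussianPDFReal 0 1 = fun x : ℝ => (√(2 * Real.pi))⁻¹ * Real.exp (-x ^ 2 / 2) :=
    funext gaussianPDFReal_std
  rw [e]
  convert h using 1
  ring

lemma gaussianReal_std_eq :
    gaussianReal 0 1 =
      volume.withDensity fun x => ((gaussianPDFReal 0 1 x).toNNReal : ℝ≥0∞) := by
  rw [gaussianReal_of_var_ne_zero 0 one_ne_zero]
  rfl

lemma setIntegral_gaussianReal_std (u : ℝ → ℝ) {s : Set ℝ} (hs : MeasurableSet s) :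
    ∫ t in s, u t ∂gaussianReal 0 1 = ∫ t in s, gaussianPDFReal 0 1 t * u t := by
  rw [gaussianReal_std_eq, setIntegral_withDensity_eq_setIntegral_smul
    (measurable_gaussianPDFReal 0 1).real_toNNReal _ hs]
  refine setIntegral_congr_fun hs fun t _ => ?_
  simp [NNReal.smul_def, gaussianPDFReal_nonneg 0 1 t]

lemma integrable_gaussianReal_std_iff {u : ℝ → ℝ} :
    Integrable u (gaussianReal 0 1) ↔ Integrable fun t => gaussianPDFReal 0 1 t * u t := by
  rw [gaussianReal_std_eq, integrable_withDensity_iff_integrable_smul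
    (measurable_gaussianPDFReal 0 1).real_toNNReal]
  simp [NNReal.smul_def, gaussianPDFReal_nonneg 0 1]

lemma hasDerivAt_setIntegral_Iic_gaussianReal {u : ℝ → ℝ} (hu : Continuous u)
    (hi : Integrable u (gaussianReal 0 1)) (w : ℝ) :
    HasDerivAt (fun w => ∫ t in Iic w, u t ∂gaussianReal 0 1)
      (gaussianPDFReal 0 1 w * u w) w := by
  have hc : Continuous fun t => gaussianPDFReal 0 1 t * u t :=
    (continuous_iff_continuousAt.2 fun x =>
      (hasDerivAt_gaussianPDFReal_std x).continuousAt).mul hu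
  have hi' := integrable_gaussianReal_std_iff.1 hi
  have h := intervalIntegral.integral_hasDerivAt_right (a := 0) (b := w)
    (hc.intervalIntegrable 0 w) (hc.stronglyMeasurableAtFilter _ _) hc.continuousAt
  have e : (fun w => ∫ t in Iic w, u t ∂gaussianReal 0 1) = fun w =>
      (∫ t in Iic 0, gaussianPDFReal 0 1 t * u t)
        + ∫ t in (0 : ℝ)..w, gaussianPDFReal 0 1 t * u t := by
    funext w
    rw [setIntegral_gaussianReal_std _ measurableSet_Iic,
      ← intervalIntegral.integral_Iic_sub_Iic hi'.integrableOn hi'.integrableOn]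
    ring
  rw [e]
  exact h.const_add _

/-- The comparison function in the lower bound for Mills' ratio. -/
noncomputable def millsLower (w : ℝ) : ℝ := w / (1 + w ^ 2) * gaussianPDFReal 0 1 w

/-- The sum of the density and the derivative is the density times 2 / (1 + w²)². Hence the
distribution function plus `millsLower` increases from 0 to 1, which yields both Mills bounds below.
-/
lemma exists_hasDerivAt_millsLower (w : ℝ) :
    ∃ d, HasDerivAt millsLower d w ∧ 0 ≤ gaussianPDFReal 0 1 w + d := by
  have h1 : HasDerivAt (fun w : ℝ => w / (1 + w ^ 2))
      ((1 * (1 + w ^ 2) - w * (2 * w)) / (1 + w ^ 2) ^ 2) w := by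
    have h2 : HasDerivAt (fun w : ℝ => 1 + w ^ 2) (2 * w) w := by
      simpa using (hasDerivAt_pow 2 w).const_add 1
    exact (hasDerivAt_id w).div h2 (by positivity)
  refine ⟨_, h1.mul (hasDerivAt_gaussianPDFReal_std w), ?_⟩
  have hp := gaussianPDFReal_nonneg 0 1 w
  have e : gaussianPDFReal 0 1 w + ((1 * (1 + w ^ 2) - w * (2 * w)) / (1 + w ^ 2) ^ 2
      * gaussianPDFReal 0 1 w + w / (1 + w ^ 2) * (-w * gaussianPDFReal 0 1 w))
      = gaussianPDFReal 0 1 w * (2 / (1 + w ^ 2) ^ 2) := by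
    field_simp
    ring
  rw [e]
  positivity

lemma abs_millsLower_le (w : ℝ) : |millsLower w| ≤ |w|⁻¹ := by
  rcases eq_or_ne w 0 with rfl | hw
  · simp [millsLower]
  have hp := gaussianPDFReal_nonneg 0 1 w
  have hp1 := gaussianPDFReal_std_le_one w
  rw [millsLower, abs_mul, abs_of_nonneg hp, abs_div, abs_of_pos (by positivity : 0 < 1 + w ^ 2)]
  have hw' : 0 < |w| := abs_pos.2 hw
  calc |w| / (1 + w ^ 2) * gaussianPDFReal 0 1 w ≤ |w| / (1 + w ^ 2) * 1 := by gcongr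
    _ ≤ |w|⁻¹ := by
        rw [mul_one, div_le_iff₀ (by positivity), ← sq_abs, inv_mul_eq_div, le_div_iff₀ hw']
        nlinarith

lemma tendsto_millsLower_atTop : Tendsto millsLower atTop (𝓝 0) :=
  squeeze_zero_norm abs_millsLower_le (tendsto_inv_atTop_zero.comp tendsto_abs_atTop_atTop)

lemma tendsto_millsLower_atBot : Tendsto millsLower atBot (𝓝 0) :=
  squeeze_zero_norm abs_millsLower_le (tendsto_inv_atTop_zero.comp tendsto_abs_atBot_atTop)

lemma monotone_cdf_add_millsLower :
    Monotone fun w => (gaussianReal 0 1).real (Iic w) + millsLower w := by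
  have hd : ∀ w, ∃ d, HasDerivAt
      (fun w => (gaussianReal 0 1).real (Iic w) + millsLower w) d w ∧ 0 ≤ d := by
    intro w
    obtain ⟨d, h1, h2⟩ := exists_hasDerivAt_millsLower w
    refine ⟨_, HasDerivAt.add ?_ h1, h2⟩
    have := hasDerivAt_setIntegral_Iic_gaussianReal (u := fun _ => 1) continuous_const
      (integrable_const _) w
    simpa using this
  refine monotone_of_deriv_nonneg (fun w => ?_) fun w => ?_
  · obtain ⟨d, h, -⟩ := hd w
    exact h.differentiableAt
  · obtain ⟨d, h, h'⟩ := hd w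
    rw [h.deriv]
    exact h'

lemma neg_millsLower_le_cdf (w : ℝ) : -millsLower w ≤ (gaussianReal 0 1).real (Iic w) := by
  have ht := (tendsto_cdf_atBot (gaussianReal 0 1)).add tendsto_millsLower_atBot
  simp_rw [cdf_eq_real, add_zero] at ht
  have := monotone_cdf_add_millsLower.le_of_tendsto ht w
  linarith

lemma millsLower_le_one_sub_cdf (w : ℝ) :
    millsLower w ≤ 1 - (gaussianReal 0 1).real (Iic w) := by
  have ht := (tendsto_cdf_atTop (gaussianReal 0 1)).add tendsto_millsLower_atTop
  simp_rw [cdf_eq_real, add_zero] at ht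
  have := monotone_cdf_add_millsLower.ge_of_tendsto ht w
  linarith

/-- The solution of Stein's equation `φ' w - w φ w = h w - ∫ h dγ`. -/
noncomputable def steinSol (h : ℝ → ℝ) (w : ℝ) : ℝ :=
  (gaussianPDFReal 0 1 w)⁻¹ *
    ∫ t in Iic w, (h t - ∫ s, h s ∂gaussianReal 0 1) ∂gaussianReal 0 1

lemma hasDerivAt_steinSol {h : ℝ → ℝ} (hc : Continuous h)
    (hi : Integrable h (gaussianReal 0 1)) (w : ℝ) :
    HasDerivAt (steinSol h) (w * steinSol h w + (h w - ∫ s, h s ∂gaussianReal 0 1)) w := by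
  have hp : gaussianPDFReal 0 1 w ≠ 0 := (gaussianPDFReal_pos 0 1 w one_ne_zero).ne'
  have h1 := (hasDerivAt_gaussianPDFReal_std w).inv hp
  have h2 := hasDerivAt_setIntegral_Iic_gaussianReal
    (u := fun t => h t - ∫ s, h s ∂gaussianReal 0 1) (hc.sub continuous_const)
    (hi.sub (integrable_const _)) w
  have h3 : HasDerivAt (steinSol h) _ w := h1.mul h2
  refine h3.congr_deriv ?_
  simp only [steinSol, Pi.inv_apply]
  field_simp

/-- For smooth k the left side is the derivative of w ↦ w φ(w). Centring k at k w splits the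
Gaussian integral into a part a ≤ 0 left of w and a part b ≥ 0 right of w. The coefficients of a and
−b are nonnegative by the two Mills bounds. -/
lemma one_add_sq_mul_steinSol_le {k : ℝ → ℝ} (hk : Monotone k)
    (hi : Integrable k (gaussianReal 0 1)) (w : ℝ) :
    (1 + w ^ 2) * steinSol k w + w * (k w - ∫ s, k s ∂gaussianReal 0 1) ≤ 0 := by
  have hp := gaussianPDFReal_pos 0 1 w one_ne_zero
  set c := (gaussianReal 0 1).real (Iic w) with hcdef
  set p := gaussianPDFReal 0 1 w with hpdef
  have hcc : (gaussianReal 0 1).real (Iic w)ᶜ = 1 - c := by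
    rw [measureReal_compl measurableSet_Iic]
    simp [hcdef]
  set a := ∫ t in Iic w, (k t - k w) ∂gaussianReal 0 1 with hadef
  set b := ∫ t in (Iic w)ᶜ, (k t - k w) ∂gaussianReal 0 1 with hbdef
  have hi' : Integrable (fun t => k t - k w) (gaussianReal 0 1) := hi.sub (integrable_const _)
  have ha : a ≤ 0 := setIntegral_nonpos measurableSet_Iic fun t ht => by
    simpa using hk ht
  have hb : 0 ≤ b := setIntegral_nonneg measurableSet_Iic.compl fun t ht => by
    simpa using hk (not_le.1 (show ¬ t ≤ w from ht)).le
  have hN : ∫ s, k s ∂gaussianReal 0 1 = k w + (a + b) := by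
    rw [hadef, hbdef, integral_add_compl measurableSet_Iic hi', integral_sub hi (integrable_const _)]
    simp
  have hS : steinSol k w = p⁻¹ * (a - c * (a + b)) := by
    rw [steinSol, hN]
    congr 1
    have : ∀ t, k t - (k w + (a + b)) = (k t - k w) - (a + b) := fun t => by ring
    simp_rw [this]
    rw [integral_sub hi'.integrableOn (integrable_const _)]
    simp [hadef, hcdef]
  have m1 := neg_millsLower_le_cdf w
  have m2 := millsLower_le_one_sub_cdf w
  rw [← hcdef, millsLower, ← hpdef] at m1 m2
  have hw : (0 : ℝ) < 1 + w ^ 2 := by positivity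
  have n1 : 0 ≤ (1 + w ^ 2) * c + w * p := by
    have : (1 + w ^ 2) * (-(w / (1 + w ^ 2) * p)) ≤ (1 + w ^ 2) * c := by gcongr
    have e : (1 + w ^ 2) * (-(w / (1 + w ^ 2) * p)) = -(w * p) := by field_simp
    linarith
  have n2 : 0 ≤ (1 + w ^ 2) * (1 - c) - w * p := by
    have : (1 + w ^ 2) * ((w / (1 + w ^ 2) * p)) ≤ (1 + w ^ 2) * (1 - c) := by gcongr
    have e : (1 + w ^ 2) * ((w / (1 + w ^ 2) * p)) = (w * p) := by field_simp
    linarith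
  rw [hS, hN]
  have e : (1 + w ^ 2) * (p⁻¹ * (a - c * (a + b))) + w * (k w - (k w + (a + b)))
      = p⁻¹ * (a * ((1 + w ^ 2) * (1 - c) - w * p) - b * ((1 + w ^ 2) * c + w * p)) := by
    field_simp
    ring
  rw [e]
  have := mul_nonpos_of_nonpos_of_nonneg ha n2
  have := mul_nonneg hb n1
  exact mul_nonpos_of_nonneg_of_nonpos (by positivity) (by linarith)

lemma integrable_id_gaussianReal_std : Integrable (fun x : ℝ => x) (gaussianReal 0 1) :=
  (memLp_id_gaussianReal 1).integrable le_rfl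

lemma integrable_of_lipschitz {μ : Measure ℝ} [IsFiniteMeasure μ]
    (hμ : Integrable (fun x : ℝ => x) μ) {h : ℝ → ℝ} (hh : LipschitzWith 1 h) :
    Integrable h μ := by
  refine Integrable.mono' (hμ.abs.add (integrable_const |h 0|))
    hh.continuous.aestronglyMeasurable (ae_of_all _ fun x => ?_)
  have := hh.dist_le_mul x 0
  simp only [Real.dist_eq, NNReal.coe_one, one_mul, sub_zero] at this
  have h2 : h x = (h x - h 0) + h 0 := by ring
  rw [Real.norm_eq_abs, h2]
  exact (abs_add_le _ _).trans (by simpa using this)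

/-- The solution for the identity is the constant −1, since t times the density is minus the
derivative of the density. -/
lemma steinSol_id (w : ℝ) :
    (1 + w ^ 2) * steinSol (fun x => x) w + w * (w - ∫ s, s ∂gaussianReal 0 1) = -1 := by
  rw [steinSol]
  simp only [integral_id_gaussianReal, sub_zero]
  have key : ∫ t in Iic w, t ∂gaussianReal 0 1 = -gaussianPDFReal 0 1 w := by
    rw [setIntegral_gaussianReal_std _ measurableSet_Iic]
    have hi := integrable_gaussianReal_std_iff.1 integrable_id_gaussianReal_std
    have ht : Tendsto (fun x => -gaussianPDFReal 0 1 x) atBot (𝓝 0) := by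
      suffices Tendsto (fun x => gaussianPDFReal 0 1 x) atBot (𝓝 0) by simpa using this.neg
      have e : gaussianPDFReal 0 1 = fun x : ℝ => (√(2 * Real.pi))⁻¹ * Real.exp (-x ^ 2 / 2) :=
        funext gaussianPDFReal_std
      simp_rw [e]
      suffices Tendsto (fun x : ℝ => -x ^ 2 / 2) atBot atBot by
        simpa using (Real.tendsto_exp_atBot.comp this).const_mul (√(2 * Real.pi))⁻¹
      have : Tendsto (fun x : ℝ => x ^ 2 / 2) atBot atTop :=
        by
        have h := (tendsto_pow_atTop (α := ℝ) two_ne_zero).comp tendsto_abs_atBot_atTop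
        refine Tendsto.atTop_div_const two_pos (h.congr fun x => ?_)
        simp
      have := tendsto_neg_atTop_atBot.comp this
      refine this.congr fun x => ?_
      simp only [Function.comp]
      ring
    have := integral_Iic_of_hasDerivAt_of_tendsto' (a := w) (m := 0)
      (f := fun x => -gaussianPDFReal 0 1 x) (f' := fun x => gaussianPDFReal 0 1 x * x)
      (fun x _ => by
        have := (hasDerivAt_gaussianPDFReal_std x).neg
        rw [show gaussianPDFReal 0 1 x * x = -(-x * gaussianPDFReal 0 1 x) by ring]
        exact this) hi.integrableOn ht
    rw [this, sub_zero]
  rw [key]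
  have hp : gaussianPDFReal 0 1 w ≠ 0 := (gaussianPDFReal_pos 0 1 w one_ne_zero).ne'
  field_simp
  ring

lemma steinSol_add {h k : ℝ → ℝ} (hh : Integrable h (gaussianReal 0 1))
    (hk : Integrable k (gaussianReal 0 1)) (w : ℝ) :
    steinSol (fun x => h x + k x) w = steinSol h w + steinSol k w := by
  simp only [steinSol]
  have e := integral_add (μ := (gaussianReal 0 1).restrict (Iic w))
    (f := fun t => h t - ∫ s, h s ∂gaussianReal 0 1)
    (g := fun t => k t - ∫ s, k s ∂gaussianReal 0 1)
    (hh.sub (integrable_const _)).integrableOn (hk.sub (integrable_const _)).integrableOn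
  rw [integral_add hh hk, ← mul_add, ← e]
  refine congrArg _ (integral_congr_ae (ae_of_all _ fun t => ?_))
  ring

lemma steinSol_neg (h : ℝ → ℝ) (w : ℝ) :
    steinSol (fun x => -h x) w = -steinSol h w := by
  have e := integral_neg (μ := (gaussianReal 0 1).restrict (Iic w))
    (f := fun t => h t - ∫ s, h s ∂gaussianReal 0 1)
  simp only [steinSol]
  rw [integral_neg, ← mul_neg, ← e]
  refine congrArg _ (integral_congr_ae (ae_of_all _ fun t => ?_))
  ring

/-- The expression is linear in h, and h + id is monotone; the identity contributes −1. Applying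
this to −h as well gives the two-sided bound. -/
lemma neg_one_le_steinSol {h : ℝ → ℝ} (hh : LipschitzWith 1 h) (w : ℝ) :
    (1 + w ^ 2) * steinSol h w + w * (h w - ∫ s, h s ∂gaussianReal 0 1) ≤ 1 := by
  have hi := integrable_of_lipschitz integrable_id_gaussianReal_std hh
  have hm : Monotone fun x => h x + x := by
    intro x y hxy
    have := hh.dist_le_mul x y
    simp only [Real.dist_eq, NNReal.coe_one, one_mul] at this
    rw [abs_sub_comm x y, abs_of_nonneg (sub_nonneg.2 hxy)] at this
    have := (abs_le.1 this).2
    simp only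
    linarith
  have := one_add_sq_mul_steinSol_le hm (hi.add integrable_id_gaussianReal_std) w
  rw [steinSol_add hi integrable_id_gaussianReal_std,
    integral_add hi integrable_id_gaussianReal_std] at this
  have := steinSol_id w
  linarith

lemma abs_one_add_sq_mul_steinSol_le {h : ℝ → ℝ} (hh : LipschitzWith 1 h) (w : ℝ) :
    |(1 + w ^ 2) * steinSol h w + w * (h w - ∫ s, h s ∂gaussianReal 0 1)| ≤ 1 := by
  have h1 := neg_one_le_steinSol hh w
  have h2 := neg_one_le_steinSol (h := fun x => -h x) hh.neg w
  rw [steinSol_neg, integral_neg] at h2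
  rw [abs_le]
  constructor <;> linarith

/-- Second-order Taylor bound without a second derivative, which need not exist when h is only
Lipschitz. Along the segment from a to b the remainder is dominated by s² (b − a)². -/
lemma abs_sub_le_sq_of_lipschitz_deriv {φ φ' : ℝ → ℝ} (hd : ∀ w, HasDerivAt φ (φ' w) w)
    (hL : ∀ a b, |φ' b - φ' a| ≤ 2 * |b - a|) (a b : ℝ) :
    |φ b - φ a - φ' a * (b - a)| ≤ (b - a) ^ 2 := by
  have hd' : ∀ s : ℝ, HasDerivAt (fun s => φ (a + s * (b - a)) - φ a - φ' a * (s * (b - a)))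
      ((φ' (a + s * (b - a)) - φ' a) * (b - a)) s := by
    intro s
    have h1 : HasDerivAt (fun s => a + s * (b - a)) (b - a) s := by
      simpa using ((hasDerivAt_id s).mul_const (b - a)).const_add a
    have h2 : HasDerivAt (fun s => s * (b - a)) (b - a) s := by
      simpa using ((hasDerivAt_id s).mul_const (b - a))
    have := (((hd (a + s * (b - a))).comp s h1).sub_const (φ a)).sub (h2.const_mul (φ' a))
    rw [show (φ' (a + s * (b - a)) - φ' a) * (b - a)
      = φ' (a + s * (b - a)) * (b - a) - φ' a * (b - a) by ring]
    exact this
  have key := image_norm_le_of_norm_deriv_right_le_deriv_boundary (a := 0) (b := 1)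
    (f := fun s => φ (a + s * (b - a)) - φ a - φ' a * (s * (b - a)))
    (B := fun s => s ^ 2 * (b - a) ^ 2) (B' := fun s => 2 * s * (b - a) ^ 2)
    (fun s _ => (hd' s).continuousAt.continuousWithinAt)
    (fun s _ => (hd' s).hasDerivWithinAt) (by simp)
    (fun s => by simpa using (hasDerivAt_pow 2 s).mul_const ((b - a) ^ 2))
    (fun s hs => by
      rw [norm_mul, Real.norm_eq_abs, Real.norm_eq_abs]
      have := hL a (a + s * (b - a))
      rw [add_sub_cancel_left, abs_mul, abs_of_nonneg hs.1] at this
      calc _ ≤ 2 * (s * |b - a|) * |b - a| := by gcongr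
        _ = 2 * s * |b - a| ^ 2 := by ring
        _ = _ := by rw [sq_abs])
    (right_mem_Icc.2 zero_le_one)
  simpa using key

/-- Stein's equation for a Lipschitz function, with the bounds on the first two derivatives of its
solution. -/
theorem exists_stein_solution {h : ℝ → ℝ} (hh : LipschitzWith 1 h) :
    ∃ φ φ' : ℝ → ℝ, (∀ w, HasDerivAt φ (φ' w) w) ∧ Continuous φ' ∧
      (∀ w, φ' w - w * φ w = h w - ∫ s, h s ∂gaussianReal 0 1) ∧
      (∀ w, |φ' w| ≤ 7) ∧ (∀ a b, |φ b - φ a - φ' a * (b - a)| ≤ (b - a) ^ 2) := by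
  have hi := integrable_of_lipschitz integrable_id_gaussianReal_std hh
  set N := ∫ s, h s ∂gaussianReal 0 1 with hN
  set φ := steinSol h with hφ
  set φ' : ℝ → ℝ := fun w => w * φ w + (h w - N) with hφ'
  have hd : ∀ w, HasDerivAt φ (φ' w) w := hasDerivAt_steinSol hh.continuous hi
  have hcφ : Continuous φ := continuous_iff_continuousAt.2 fun w => (hd w).continuousAt
  -- φ' is w φ(w), with derivative bounded by 1, plus the 1-Lipschitz function h up to a constant.
  have hL : ∀ a b, |φ' b - φ' a| ≤ 2 * |b - a| := by
    intro a b
    have h1 : ∀ w, HasDerivAt (fun w => w * φ w)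
        ((1 + w ^ 2) * φ w + w * (h w - N)) w := by
      intro w
      refine HasDerivAt.congr_deriv ((hasDerivAt_id w).mul (hd w)) ?_
      simp only [hφ', id]
      ring
    have h2 := Convex.norm_image_sub_le_of_norm_hasDerivWithin_le (s := univ)
      (fun w _ => (h1 w).hasDerivWithinAt)
      (fun w _ => abs_one_add_sq_mul_steinSol_le hh w) convex_univ (mem_univ a) (mem_univ b)
    have h3 := hh.dist_le_mul b a
    simp only [Real.dist_eq, NNReal.coe_one, one_mul, Real.norm_eq_abs] at h2 h3
    have e : φ' b - φ' a = (b * φ b - a * φ a) + (h b - h a) := by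
      simp only [hφ']
      ring
    rw [e]
    exact (abs_add_le _ _).trans (by linarith)
  have hT := abs_sub_le_sq_of_lipschitz_deriv hd hL
  have hm : ∫ s, |s| ∂gaussianReal 0 1 ≤ 1 := by
    have hi2 : Integrable (fun x : ℝ => x ^ 2) (gaussianReal 0 1) :=
      (memLp_id_gaussianReal 2).integrable_sq
    have hv : ∫ s, s ^ 2 ∂gaussianReal 0 1 = 1 := by
      have := variance_id_gaussianReal (μ := 0) (v := 1)
      rw [variance_of_integral_eq_zero aemeasurable_id (by simp [integral_id_gaussianReal])] at this
      simpa using this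
    calc ∫ s, |s| ∂gaussianReal 0 1 ≤ ∫ s, (s ^ 2 + 1) / 2 ∂gaussianReal 0 1 := by
          refine integral_mono integrable_id_gaussianReal_std.abs
            ((hi2.add (integrable_const 1)).div_const 2) fun s => ?_
          nlinarith [sq_nonneg (|s| - 1), sq_abs s]
      _ = 1 := by
          rw [integral_div, integral_add hi2 (integrable_const 1), hv]
          simp
  have hc : ∀ w, |h w - N| ≤ |w| + 1 := by
    intro w
    have e : h w - N = ∫ s, (h w - h s) ∂gaussianReal 0 1 := by
      rw [integral_sub (integrable_const _) hi]
      simp [hN]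
    rw [e]
    calc |∫ s, (h w - h s) ∂gaussianReal 0 1| ≤ ∫ s, |h w - h s| ∂gaussianReal 0 1 :=
          abs_integral_le_integral_abs
      _ ≤ ∫ s, (|w| + |s|) ∂gaussianReal 0 1 := by
          refine integral_mono ((integrable_const _).sub hi).abs
            ((integrable_const _).add integrable_id_gaussianReal_std.abs) fun s => ?_
          have h3 := hh.dist_le_mul w s
          simp only [Real.dist_eq, NNReal.coe_one, one_mul] at h3
          exact h3.trans (abs_sub _ _)
      _ = |w| + ∫ s, |s| ∂gaussianReal 0 1 := by
          rw [integral_add (integrable_const _) integrable_id_gaussianReal_std.abs]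
          simp
      _ ≤ |w| + 1 := by gcongr
  have hb : ∀ w, |φ w| ≤ 3 := by
    intro w
    have h1 := abs_one_add_sq_mul_steinSol_le hh w
    rw [← hφ, ← hN] at h1
    have h2 : |w * (h w - N)| ≤ |w| * (|w| + 1) := by
      rw [abs_mul]
      exact mul_le_mul_of_nonneg_left (hc w) (abs_nonneg w)
    have h3 : (1 + w ^ 2) * |φ w| ≤ 1 + |w| * (|w| + 1) := by
      have e : (1 + w ^ 2) * |φ w| = |(1 + w ^ 2) * φ w| := by
        rw [abs_mul, abs_of_pos (by positivity : 0 < 1 + w ^ 2)]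
      rw [e]
      have e2 : (1 + w ^ 2) * φ w
        = ((1 + w ^ 2) * φ w + w * (h w - N)) - w * (h w - N) := by ring
      rw [e2]
      exact (abs_sub _ _).trans (by linarith)
    have h4 : 0 < 1 + w ^ 2 := by positivity
    nlinarith [sq_nonneg (|w| - 1), sq_abs w]
  refine ⟨φ, φ', hd, ?_, fun w => by simp [hφ'], fun w => ?_, hT⟩
  · exact (continuous_id.mul hcφ).add (hh.continuous.sub continuous_const)
  -- φ'(w) is within 1 of φ(w + 1) − φ(w), and |φ| ≤ 3, so 7 = 3 + 3 + 1.
  · have h1 := hT w (w + 1)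
    have h2 := hb w
    have h3 := hb (w + 1)
    simp only [add_sub_cancel_left, mul_one, one_pow] at h1
    rw [abs_le] at h1 h2 h3 ⊢
    constructor <;> linarith

end Stein

end NormalApprox

namespace NormalApprox

/-! ### Weights of a uniformly random chain of subsets -/

section Weights

open Finset

variable {n : ℕ}

/-- The weight of the proper subset `A` of `Fin n` in the covariance identity; it vanishes for
`A = univ`. -/
noncomputable def weight (A : Finset (Fin n)) : ℝ := 1 / (n.choose #A * (n - #A))

lemma weight_nonneg (A : Finset (Fin n)) : 0 ≤ weight A := by
  have : (#A : ℝ) ≤ n := by exact_mod_cast card_finset_fin_le A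
  exact div_nonneg zero_le_one (mul_nonneg (Nat.cast_nonneg _) (sub_nonneg.2 this))

/-- `weight A` is the probability that a uniform maximal chain visits A and then adds a given j ∉ A.
Summing over j leaves the probability 1 / C(n, |A|) of visiting A, except that `univ` has no
successor. -/
lemma sum_compl_weight_mul (F : Finset (Fin n) → ℝ) :
    ∑ A : Finset (Fin n), ∑ _j ∈ Aᶜ, weight A * F A
      = (∑ A : Finset (Fin n), 1 / (n.choose #A : ℝ) * F A) - F univ := by
  have h : ∀ A : Finset (Fin n), ∑ _j ∈ Aᶜ, weight A * F A
      = 1 / (n.choose #A : ℝ) * F A - if A = univ then F A else 0 := by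
    intro A
    have hle : #A ≤ n := card_finset_fin_le A
    rw [sum_const, card_compl, Fintype.card_fin, nsmul_eq_mul, Nat.cast_sub hle, weight]
    split_ifs with hA
    · subst hA
      simp
    · have hlt : #A < n := by
        refine lt_of_le_of_ne hle fun h => hA ?_
        rw [← card_eq_iff_eq_univ, h, Fintype.card_fin]
      have h1 : (n.choose #A : ℝ) ≠ 0 := by exact_mod_cast (Nat.choose_pos hle).ne'
      have h2 : (n - #A : ℝ) ≠ 0 := sub_ne_zero.2 (by exact_mod_cast hlt.ne')
      field_simp
      ring
  simp_rw [h, sum_sub_distrib]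
  simp

/-- The same steps indexed by their endpoint B = A ∪ {j}: now ∅ is the only set missing. The weights
match because (k + 1) C(n, k + 1) = (n − k) C(n, k). -/
lemma sum_compl_weight_mul_insert (F : Finset (Fin n) → ℝ) :
    ∑ A : Finset (Fin n), ∑ j ∈ Aᶜ, weight A * F (insert j A)
      = (∑ A : Finset (Fin n), 1 / (n.choose #A : ℝ) * F A) - F ∅ := by
  have h0 : ∑ A : Finset (Fin n), ∑ j ∈ Aᶜ, weight A * F (insert j A)
      = ∑ B : Finset (Fin n), ∑ j ∈ B, weight (B.erase j) * F B := by
    rw [sum_sigma', sum_sigma']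
    refine sum_bij' (fun p _ => ⟨insert p.2 p.1, p.2⟩) (fun p _ => ⟨p.1.erase p.2, p.2⟩)
      ?_ ?_ ?_ ?_ ?_
    · rintro ⟨A, j⟩ _
      simp
    · rintro ⟨A, j⟩ _
      simp
    · rintro ⟨A, j⟩ h
      simp only [mem_sigma, mem_univ, mem_compl, true_and] at h
      simp [erase_insert h]
    · rintro ⟨A, j⟩ h
      simp only [mem_sigma, mem_univ, true_and] at h
      simp [insert_erase h]
    · rintro ⟨A, j⟩ h
      simp only [mem_sigma, mem_univ, mem_compl, true_and] at h
      simp [erase_insert h]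
  have h : ∀ B : Finset (Fin n), ∑ j ∈ B, weight (B.erase j) * F B
      = 1 / (n.choose #B : ℝ) * F B - if B = ∅ then F B else 0 := by
    intro B
    have hle : #B ≤ n := card_finset_fin_le B
    split_ifs with hB
    · subst hB
      simp
    · obtain ⟨k, hk⟩ : ∃ k, #B = k + 1 := Nat.exists_eq_succ_of_ne_zero (by simpa using hB)
      have hj : ∀ j ∈ B, weight (B.erase j) * F B = 1 / (n.choose k * (n - k)) * F B := by
        intro j hj
        rw [weight, card_erase_of_mem hj, hk]
        simp
      rw [sum_congr rfl hj, sum_const, hk, nsmul_eq_mul, sub_zero]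
      have hkn : k < n := by omega
      have e := Nat.choose_succ_right_eq n k
      have e' : (n.choose (k + 1) : ℝ) * (k + 1) = n.choose k * (n - k) := by
        rw [← Nat.cast_sub hkn.le]
        exact_mod_cast e
      have h1 : (n.choose (k + 1) : ℝ) ≠ 0 := by
        exact_mod_cast (Nat.choose_pos (by omega : k + 1 ≤ n)).ne'
      rw [← e', ← mul_assoc]
      congr 1
      push_cast
      field_simp
  rw [h0]
  simp_rw [h, sum_sub_distrib]
  simp

/-- Telescoping over a uniformly random chain of subsets from `∅` to `univ`. -/
lemma sum_weight_mul_sub (F : Finset (Fin n) → ℝ) :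
    ∑ A : Finset (Fin n), weight A * ∑ j ∈ Aᶜ, (F A - F (insert j A)) = F ∅ - F univ := by
  simp_rw [mul_sum, mul_sub, sum_sub_distrib]
  rw [sum_compl_weight_mul, sum_compl_weight_mul_insert]
  ring

/-- Every j is added exactly once along a chain, so its total weight is 1; formally, telescope the
function A ↦ Σ_{k∉A} a_k. -/
lemma sum_weight_mul_sum_compl (a : Fin n → ℝ) :
    ∑ A : Finset (Fin n), weight A * ∑ j ∈ Aᶜ, a j = ∑ j, a j := by
  have h := sum_weight_mul_sub fun A : Finset (Fin n) => ∑ k ∈ Aᶜ, a k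
  simp only [compl_empty, compl_univ, sum_empty, sub_zero] at h
  rw [← h]
  refine sum_congr rfl fun A _ => ?_
  congr 1
  refine sum_congr rfl fun j hj => ?_
  rw [compl_insert, ← add_sum_erase _ _ hj]
  ring

/-- The summand is m^{-3/4}, with value 0 at m = 0. It is compared with an increment of 4 m^{1/4}
through 1 = c⁴ − a⁴ ≤ 4 c³ (c − a). -/
lemma sum_sqrt_sqrt_div_le (n : ℕ) :
    ∑ m ∈ range (n + 1), √√(m : ℝ) / m ≤ 4 * √√(n : ℝ) := by
  induction n with
  | zero => simp
  | succ m ih =>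
    rw [sum_range_succ]
    set c := √√((m + 1 : ℕ) : ℝ) with hc
    set a := √√(m : ℝ) with ha
    have ha0 : 0 ≤ a := Real.sqrt_nonneg _
    have hc4 : c ^ 4 = m + 1 := by
      rw [hc, show (4 : ℕ) = 2 * 2 from rfl, pow_mul, Real.sq_sqrt (Real.sqrt_nonneg _),
        Real.sq_sqrt (Nat.cast_nonneg _)]
      push_cast
      rfl
    have ha4 : a ^ 4 = m := by
      rw [ha, show (4 : ℕ) = 2 * 2 from rfl, pow_mul, Real.sq_sqrt (Real.sqrt_nonneg _),
        Real.sq_sqrt (Nat.cast_nonneg _)]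
    have hac : a ≤ c := by
      apply Real.sqrt_le_sqrt
      apply Real.sqrt_le_sqrt
      push_cast
      linarith
    have hcpos : 0 < c := by
      apply Real.sqrt_pos.2
      apply Real.sqrt_pos.2
      positivity
    have key : c / ((m + 1 : ℕ) : ℝ) ≤ 4 * (c - a) := by
      push_cast
      rw [← hc4, div_le_iff₀ (by positivity)]
      have h1 : 1 = (c - a) * (c ^ 3 + c ^ 2 * a + c * a ^ 2 + a ^ 3) := by
        have : (c - a) * (c ^ 3 + c ^ 2 * a + c * a ^ 2 + a ^ 3) = c ^ 4 - a ^ 4 := by ring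
        rw [this, hc4, ha4]
        ring
      have h2 : c ^ 3 + c ^ 2 * a + c * a ^ 2 + a ^ 3 ≤ 4 * c ^ 3 := by
        have e1 : c ^ 2 * a ≤ c ^ 2 * c := by gcongr
        have e2 : c * a ^ 2 ≤ c * c ^ 2 := by gcongr
        have e3 : a ^ 3 ≤ c ^ 3 := by gcongr
        nlinarith
      have h3 : 1 ≤ (c - a) * (4 * c ^ 3) := by
        calc (1 : ℝ) = _ := h1
          _ ≤ _ := mul_le_mul_of_nonneg_left h2 (sub_nonneg.2 hac)
      nlinarith
    linarith

/-- Grouping the sets by cardinality cancels the binomial coefficient and leaves the preceding sum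
in m = n − |A|. -/
lemma sum_weight_mul_sqrt_sqrt_le (n : ℕ) :
    ∑ A : Finset (Fin n), weight A * √√(n - #A : ℝ) ≤ 4 * √√(n : ℝ) := by
  refine le_trans (le_of_eq ?_) (sum_sqrt_sqrt_div_le n)
  have h := sum_powerset_apply_card
    (x := (univ : Finset (Fin n)))
    (fun k => 1 / (n.choose k * (n - k) : ℝ) * √√(n - k : ℝ))
  rw [powerset_univ, card_univ, Fintype.card_fin] at h
  simp only [weight]
  rw [h, ← sum_range_reflect (fun m => √√(m : ℝ) / m) (n + 1)]
  refine sum_congr rfl fun k hk => ?_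
  have hk : k ≤ n := Nat.lt_succ_iff.1 (mem_range.1 hk)
  have h1 : (n.choose k : ℝ) ≠ 0 := by exact_mod_cast (Nat.choose_pos hk).ne'
  rw [Nat.add_sub_cancel, Nat.cast_sub hk, nsmul_eq_mul]
  field_simp

end Weights

end NormalApprox

namespace NormalApprox

/-! ### Mixing two vectors coordinatewise -/

section Mix

variable {𝒳 : Type*} {n : ℕ}

/-- The vector `x` with the coordinates in `A` replaced by those of `x'`. -/
def mix (A : Finset (Fin n)) (x x' : Fin n → 𝒳) : Fin n → 𝒳 :=
  fun k => if k ∈ A then x' k else x k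

/-- Exchange the coordinates in `A` of two vectors. -/
def swapOn (A : Finset (Fin n)) (p : (Fin n → 𝒳) × (Fin n → 𝒳)) :
    (Fin n → 𝒳) × (Fin n → 𝒳) := (mix A p.1 p.2, mix A p.2 p.1)

lemma mix_empty (x x' : Fin n → 𝒳) : mix ∅ x x' = x := by
  funext k
  simp [mix]

lemma mix_univ (x x' : Fin n → 𝒳) : mix Finset.univ x x' = x' := by
  funext k
  simp [mix]

lemma replace_eq_mix (x x' : Fin n → 𝒳) (j : Fin n) : replace x x' j = mix {j} x x' := by
  funext k
  rcases eq_or_ne k j with rfl | h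
  · simp [replace, mix]
  · simp [replace, mix, h]

lemma replace_swapOn {A : Finset (Fin n)} {j : Fin n} (hj : j ∉ A)
    (p : (Fin n → 𝒳) × (Fin n → 𝒳)) :
    replace (swapOn A p).1 (swapOn A p).2 j = mix (insert j A) p.1 p.2 := by
  funext k
  rcases eq_or_ne k j with rfl | h
  · simp [replace, swapOn, mix, hj]
  · simp [replace, swapOn, mix, h]

/-- Swapping X_j and X'_j exchanges X^A and X^{A ∪ {j}}; together with the next lemma, this is the
source of the antisymmetry of the covariance increments. -/
lemma mix_swapOn_singleton {A : Finset (Fin n)} {j : Fin n} (hj : j ∉ A)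
    (p : (Fin n → 𝒳) × (Fin n → 𝒳)) :
    mix A (swapOn {j} p).1 (swapOn {j} p).2 = mix (insert j A) p.1 p.2 := by
  funext k
  rcases eq_or_ne k j with rfl | h
  · simp [swapOn, mix, hj]
  · simp [swapOn, mix, h]

lemma mix_insert_swapOn_singleton {A : Finset (Fin n)} {j : Fin n} (hj : j ∉ A)
    (p : (Fin n → 𝒳) × (Fin n → 𝒳)) :
    mix (insert j A) (swapOn {j} p).1 (swapOn {j} p).2 = mix A p.1 p.2 := by
  funext k
  rcases eq_or_ne k j with rfl | h
  · simp [swapOn, mix, hj]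
  · simp [swapOn, mix, h]

/-- The randomized derivative as a function of a pair of vectors. -/
def pairDelta (f : (Fin n → 𝒳) → ℝ) (j : Fin n) (p : (Fin n → 𝒳) × (Fin n → 𝒳)) : ℝ :=
  delta f p.1 p.2 j

lemma pairDelta_swapOn (f : (Fin n → 𝒳) → ℝ) {A : Finset (Fin n)} {j : Fin n} (hj : j ∉ A)
    (p : (Fin n → 𝒳) × (Fin n → 𝒳)) :
    pairDelta f j (swapOn A p) = f (mix A p.1 p.2) - f (mix (insert j A) p.1 p.2) := by
  rw [pairDelta, delta, replace_swapOn hj]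
  rfl

lemma pairDelta_eq (f : (Fin n → 𝒳) → ℝ) (j : Fin n) (p : (Fin n → 𝒳) × (Fin n → 𝒳)) :
    pairDelta f j p = f p.1 - f (replace p.1 p.2 j) := rfl

end Mix

/-! ### Covariance identity and Efron–Stein inequality on product spaces -/

section ProductMeasure

variable {𝒳 : Type*} [MeasurableSpace 𝒳] (μ : Measure 𝒳)

/-- The law of a family of independent random variables with common law `μ`. -/
noncomputable abbrev iid (ι : Type*) [Fintype ι] : Measure (ι → 𝒳) := Measure.pi fun _ => μ

/-- The law of a random vector and an independent copy of it. -/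
noncomputable abbrev iidPair (n : ℕ) : Measure ((Fin n → 𝒳) × (Fin n → 𝒳)) :=
  (iid μ (Fin n)).prod (iid μ (Fin n))

variable [IsProbabilityMeasure μ]

/-- Distinct members of an i.i.d. family are again i.i.d. The exchangeability statements below,
including the invariance under `swapOn`, are instances of this for a suitable reindexing. -/
lemma measurePreserving_comp_injective {ι κ : Type*} [Fintype ι] [Fintype κ] {e : κ → ι}
    (he : Function.Injective e) :
    MeasurePreserving (fun ω : ι → 𝒳 => ω ∘ e) (iid μ ι) (iid μ κ) := by
  refine ⟨by fun_prop, ?_⟩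
  have h1 : iIndepFun (fun (i : ι) (ω : ι → 𝒳) => ω i) (iid μ ι) :=
    iIndepFun_pi (X := fun _ x => x) fun _ => aemeasurable_id
  have h2 := h1.precomp he
  rw [iIndepFun_iff_map_fun_eq_pi_map fun k => (measurable_pi_apply _).aemeasurable] at h2
  refine h2.trans ?_
  congr 1
  funext k
  exact (measurePreserving_eval (fun _ : ι => μ) (e k)).map_eq

lemma measurePreserving_sumElim (κ κ' : Type*) [Fintype κ] [Fintype κ'] :
    MeasurePreserving (fun p : (κ → 𝒳) × (κ' → 𝒳) => (Sum.elim p.1 p.2 : κ ⊕ κ' → 𝒳))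
      ((iid μ κ).prod (iid μ κ')) (iid μ (κ ⊕ κ')) := by
  have h := (measurePreserving_sumPiEquivProdPi (fun _ : κ ⊕ κ' => μ)).symm
  convert h using 1
  funext p k
  cases k <;> rfl

lemma measurePreserving_sumElim_comp {κ κ' ι : Type*} [Fintype κ] [Fintype κ'] [Fintype ι]
    {e : ι → κ ⊕ κ'} (he : Function.Injective e) :
    MeasurePreserving (fun p : (κ → 𝒳) × (κ' → 𝒳) => Sum.elim p.1 p.2 ∘ e)
      ((iid μ κ).prod (iid μ κ')) (iid μ ι) :=
  (measurePreserving_comp_injective μ he).comp (measurePreserving_sumElim μ κ κ')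

variable {μ} {n : ℕ}

variable (μ) in
lemma measurePreserving_swapOn (A : Finset (Fin n)) :
    MeasurePreserving (swapOn A) (iidPair μ n) (iidPair μ n) := by
  let e : Fin n ⊕ Fin n → Fin n ⊕ Fin n :=
    Sum.elim (fun k => if k ∈ A then Sum.inr k else Sum.inl k)
      (fun k => if k ∈ A then Sum.inl k else Sum.inr k)
  have he : Function.Injective e := by
    rintro (a | a) (b | b) h <;> simp only [e, Sum.elim_inl, Sum.elim_inr] at h <;>
      split_ifs at h <;> simp_all
  have h := (measurePreserving_sumPiEquivProdPi (fun _ : Fin n ⊕ Fin n => μ)).comp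
    (measurePreserving_sumElim_comp μ he)
  convert h using 1
  funext p
  refine Prod.ext (funext fun k => ?_) (funext fun k => ?_)
  · change (if k ∈ A then p.2 k else p.1 k) = Sum.elim p.1 p.2 (e (Sum.inl k))
    simp only [e, Sum.elim_inl]
    split_ifs <;> rfl
  · change (if k ∈ A then p.1 k else p.2 k) = Sum.elim p.1 p.2 (e (Sum.inr k))
    simp only [e, Sum.elim_inr]
    split_ifs <;> rfl

variable (μ) in
lemma measurePreserving_mix (A : Finset (Fin n)) :
    MeasurePreserving (fun p : (Fin n → 𝒳) × (Fin n → 𝒳) => mix A p.1 p.2)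
      (iidPair μ n) (iid μ (Fin n)) :=
  measurePreserving_fst.comp (measurePreserving_swapOn μ A)

variable (μ) in
lemma measurePreserving_replace (i : Fin n) :
    MeasurePreserving (fun p : (Fin n → 𝒳) × (Fin n → 𝒳) => replace p.1 p.2 i)
      (iidPair μ n) (iid μ (Fin n)) := by
  simp_rw [replace_eq_mix]
  exact measurePreserving_mix μ {i}

lemma measurable_replace (j : Fin n) :
    Measurable fun p : (Fin n → 𝒳) × (Fin n → 𝒳) => replace p.1 p.2 j := by
  refine measurable_pi_lambda _ fun k => ?_
  rcases eq_or_ne k j with rfl | h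
  · simp only [replace, Function.update_self]
    fun_prop
  · simp only [replace, Function.update_of_ne h]
    fun_prop

lemma measurable_pairDelta {f : (Fin n → 𝒳) → ℝ} (hf : Measurable f) (j : Fin n) :
    Measurable (pairDelta f j) :=
  (hf.comp measurable_fst).sub (hf.comp (measurable_replace j))

lemma memLp_pairDelta {f : (Fin n → 𝒳) → ℝ} {q : ℝ≥0∞} (hf : MemLp f q (iid μ (Fin n)))
    (j : Fin n) : MemLp (pairDelta f j) q (iidPair μ n) :=
  (hf.comp_measurePreserving measurePreserving_fst).sub
    (hf.comp_measurePreserving (measurePreserving_replace μ j))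

lemma memLp_pairDelta_swapOn {f : (Fin n → 𝒳) → ℝ} {q : ℝ≥0∞} {j : Fin n}
    (hf : MemLp (pairDelta f j) q (iidPair μ n)) (A : Finset (Fin n)) :
    MemLp (fun p => pairDelta f j (swapOn A p)) q (iidPair μ n) :=
  hf.comp_measurePreserving (measurePreserving_swapOn μ A)

/-- Swapping the j-th coordinates preserves the law, flips the sign of the increment of f and turns
g(X) into g(X^j). Averaging the two expressions produces Δ_j g. -/
lemma integral_mul_sub_eq_half {f g : (Fin n → 𝒳) → ℝ} (hf : MemLp f 2 (iid μ (Fin n)))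
    (hg : MemLp g 2 (iid μ (Fin n))) {A : Finset (Fin n)} {j : Fin n} (hj : j ∉ A) :
    ∫ p, g p.1 * (f (mix A p.1 p.2) - f (mix (insert j A) p.1 p.2)) ∂iidPair μ n
      = 1 / 2 * ∫ p, pairDelta g j p * pairDelta f j (swapOn A p) ∂iidPair μ n := by
  have hd := memLp_pairDelta_swapOn (memLp_pairDelta hf j) A
  have hsw := measurePreserving_swapOn μ ({j} : Finset (Fin n))
  have hg1 : MemLp (fun p : (Fin n → 𝒳) × (Fin n → 𝒳) => g p.1) 2 (iidPair μ n) :=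
    hg.comp_measurePreserving measurePreserving_fst
  have hi : Integrable (fun p => g p.1 * pairDelta f j (swapOn A p)) (iidPair μ n) :=
    hg1.integrable_mul hd
  have hi2 : Integrable (fun p => g (replace p.1 p.2 j) * pairDelta f j (swapOn A p))
      (iidPair μ n) :=
    (hg.comp_measurePreserving (measurePreserving_replace μ j)).integrable_mul hd
  have e1 : ∫ p, g p.1 * pairDelta f j (swapOn A p) ∂iidPair μ n
      = -∫ p, g (replace p.1 p.2 j) * pairDelta f j (swapOn A p) ∂iidPair μ n := by
    have hi' : AEStronglyMeasurable (fun p => g p.1 * pairDelta f j (swapOn A p))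
      ((iidPair μ n).map (swapOn {j})) := by
      rw [hsw.map_eq]
      exact hi.aestronglyMeasurable
    have h := integral_map hsw.measurable.aemeasurable hi'
    rw [hsw.map_eq] at h
    rw [h, ← integral_neg]
    refine integral_congr_ae (ae_of_all _ fun p => ?_)
    simp only [pairDelta_swapOn f hj, mix_swapOn_singleton hj, mix_insert_swapOn_singleton hj,
      replace_eq_mix]
    simp only [swapOn]
    ring
  have e2 : ∫ p, pairDelta g j p * pairDelta f j (swapOn A p) ∂iidPair μ n
      = ∫ p, g p.1 * pairDelta f j (swapOn A p) ∂iidPair μ n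
        - ∫ p, g (replace p.1 p.2 j) * pairDelta f j (swapOn A p) ∂iidPair μ n := by
    rw [← integral_sub hi hi2]
    refine integral_congr_ae (ae_of_all _ fun p => ?_)
    simp only [pairDelta_eq g]
    ring
  simp_rw [← pairDelta_swapOn f hj]
  linarith

/-- The covariance of two functions of independent random variables in terms of randomized
derivatives. -/
theorem integral_mul_sub_integral_mul_integral {f g : (Fin n → 𝒳) → ℝ}
    (hf : MemLp f 2 (iid μ (Fin n))) (hg : MemLp g 2 (iid μ (Fin n))) :
    ∫ x, g x * f x ∂iid μ (Fin n) - (∫ x, g x ∂iid μ (Fin n)) * ∫ x, f x ∂iid μ (Fin n)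
      = 1 / 2 * ∑ A : Finset (Fin n), weight A * ∑ j ∈ Aᶜ,
          ∫ p, pairDelta g j p * pairDelta f j (swapOn A p) ∂iidPair μ n := by
  have hg1 : MemLp (fun p : (Fin n → 𝒳) × (Fin n → 𝒳) => g p.1) 2 (iidPair μ n) :=
    hg.comp_measurePreserving measurePreserving_fst
  have hI : ∀ A : Finset (Fin n),
      Integrable (fun p => g p.1 * f (mix A p.1 p.2)) (iidPair μ n) := fun A =>
    hg1.integrable_mul (hf.comp_measurePreserving (measurePreserving_mix μ A))
  have h0 : ∫ p, g p.1 * f (mix ∅ p.1 p.2) ∂iidPair μ n = ∫ x, g x * f x ∂iid μ (Fin n) := by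
    simp_rw [mix_empty]
    rw [integral_fun_fst (fun x => g x * f x)]
    simp
  have h1 : ∫ p, g p.1 * f (mix Finset.univ p.1 p.2) ∂iidPair μ n
      = (∫ x, g x ∂iid μ (Fin n)) * ∫ x, f x ∂iid μ (Fin n) := by
    simp_rw [mix_univ]
    exact integral_prod_mul g f
  -- The endpoints of the chain are E g(X) f(X) at ∅ and E g(X) f(X') = E g E f at `univ`.
  have h2 := sum_weight_mul_sub fun A : Finset (Fin n) =>
    ∫ p, g p.1 * f (mix A p.1 p.2) ∂iidPair μ n
  rw [h0, h1] at h2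
  rw [← h2, Finset.mul_sum]
  refine Finset.sum_congr rfl fun A _ => ?_
  rw [mul_left_comm, Finset.mul_sum (a := (1 / 2 : ℝ))]
  congr 1
  refine Finset.sum_congr rfl fun j hj => ?_
  rw [← integral_mul_sub_eq_half hf hg (Finset.mem_compl.1 hj), ← integral_sub (hI _) (hI _)]
  refine integral_congr_ae (ae_of_all _ fun p => ?_)
  simp only
  ring

/-- The Efron–Stein inequality. -/
theorem integral_sub_integral_sq_le {g : (Fin n → 𝒳) → ℝ} (hg : MemLp g 2 (iid μ (Fin n))) :
    ∫ x, (g x - ∫ y, g y ∂iid μ (Fin n)) ^ 2 ∂iid μ (Fin n)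
      ≤ 1 / 2 * ∑ j, ∫ p, pairDelta g j p ^ 2 ∂iidPair μ n := by
  have h0 : ∫ x, (g x - ∫ y, g y ∂iid μ (Fin n)) ^ 2 ∂iid μ (Fin n)
      = ∫ x, g x * g x ∂iid μ (Fin n)
        - (∫ x, g x ∂iid μ (Fin n)) * ∫ x, g x ∂iid μ (Fin n) := by
    have h := variance_eq_sub hg
    rw [variance_eq_integral hg.aestronglyMeasurable.aemeasurable] at h
    rw [h]
    simp [pow_two]
  -- Take f = g in the covariance identity and bound each product by half the sum of squares; both
  -- factors have the same law, and each j has total weight 1.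
  rw [h0, integral_mul_sub_integral_mul_integral hg hg, ← sum_weight_mul_sum_compl]
  refine mul_le_mul_of_nonneg_left (Finset.sum_le_sum fun A _ => mul_le_mul_of_nonneg_left
    (Finset.sum_le_sum fun j _ => ?_) (weight_nonneg A)) (by norm_num)
  have h1 := memLp_pairDelta hg j
  have h2 := memLp_pairDelta_swapOn h1 A
  have hs := measurePreserving_swapOn μ A
  have e : ∫ p, pairDelta g j (swapOn A p) ^ 2 ∂iidPair μ n
      = ∫ p, pairDelta g j p ^ 2 ∂iidPair μ n := by
    have hm : AEStronglyMeasurable (fun p => pairDelta g j p ^ 2)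
      ((iidPair μ n).map (swapOn A)) := by
      rw [hs.map_eq]
      exact h1.integrable_sq.aestronglyMeasurable
    have h := integral_map hs.measurable.aemeasurable hm
    rw [hs.map_eq] at h
    exact h.symm
  calc ∫ p, pairDelta g j p * pairDelta g j (swapOn A p) ∂iidPair μ n
      ≤ ∫ p, (1 / 2 * pairDelta g j p ^ 2 + 1 / 2 * pairDelta g j (swapOn A p) ^ 2)
          ∂iidPair μ n := by
        refine integral_mono (h1.integrable_mul h2)
          ((h1.integrable_sq.const_mul _).add (h2.integrable_sq.const_mul _)) fun p => ?_
        nlinarith [sq_nonneg (pairDelta g j p - pairDelta g j (swapOn A p))]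
    _ = _ := by
        rw [integral_add (h1.integrable_sq.const_mul _) (h2.integrable_sq.const_mul _),
          integral_const_mul, integral_const_mul, e]
        ring

end ProductMeasure

end NormalApprox

namespace NormalApprox

/-! ### Fourth moments from factorial moments -/

section Counting

open Finset

/-- The linear term takes care of s < 4, where the falling factorial vanishes. Only the first and
the fourth factorial moments are then needed. -/
lemma pow_four_le_descFactorial (s : ℕ) : s ^ 4 ≤ 81 * s + 11 * s.descFactorial 4 := by
  rcases lt_or_ge s 4 with h | h
  · interval_cases s <;> decide
  · obtain ⟨t, rfl⟩ := Nat.exists_eq_add_of_le' h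
    simp only [Nat.succ_descFactorial_succ, Nat.descFactorial_zero]
    nlinarith [Nat.zero_le t, Nat.zero_le (t ^ 2), Nat.zero_le (t ^ 3), Nat.zero_le (t ^ 4)]

/-- After cancelling one factor this is monotonicity of the falling factorial of order 3. Giving up
only the remaining factors keeps the gain s / n. -/
lemma mul_descFactorial_four_le {s n : ℕ} (h : s ≤ n) :
    n * s.descFactorial 4 ≤ s * n.descFactorial 4 := by
  rcases s with _ | s
  · simp
  obtain ⟨m, rfl⟩ : ∃ m, n = m + 1 := ⟨n - 1, by omega⟩
  rw [Nat.succ_descFactorial_succ, Nat.succ_descFactorial_succ, mul_left_comm]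
  have := Nat.descFactorial_le 3 (Nat.le_of_succ_le_succ h)
  gcongr

open Classical in
lemma card_embedding_mem {ι : Type*} [Fintype ι] (r : ℕ) (t : Finset ι) :
    #{e : Fin r ↪ ι | ∀ k, e k ∈ t} = (#t).descFactorial r := by
  have h := Fintype.card_embedding_eq (α := Fin r) (β := t)
  rw [Fintype.card_coe, Fintype.card_fin] at h
  rw [← h, ← Fintype.card_subtype]
  exact Fintype.card_congr
    { toFun := fun e => Function.Embedding.codRestrict _ e.1 e.2
      invFun := fun g => ⟨g.trans (Function.Embedding.subtype _), fun k => (g k).2⟩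
      left_inv := fun e => rfl
      right_inv := fun g => rfl }

open Classical in
/-- The factorial moments of the number of events that occur, if all probabilities of joint
occurrences of `r` of them coincide. -/
lemma lintegral_card_descFactorial {Ω ι : Type*} [MeasurableSpace Ω] (P : Measure Ω) [Fintype ι]
    (R : Ω → ι → Prop) (hR : ∀ j, MeasurableSet {ω | R ω j}) (s : Finset ι) (r : ℕ) (p : ℝ≥0∞)
    (hp : ∀ e : Fin r ↪ ι, (∀ k, e k ∈ s) → P {ω | ∀ k, R ω (e k)} = p) :
    ∫⁻ ω, ((#{j ∈ s | R ω j}).descFactorial r : ℝ≥0∞) ∂P = (#s).descFactorial r * p := by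
  have hm : ∀ e : Fin r ↪ ι, MeasurableSet {ω | ∀ k, R ω (e k)} := fun e => by
    rw [Set.ofPred_forall]
    exact MeasurableSet.iInter fun k => hR (e k)
  have h1 : ∀ ω, ((#{j ∈ s | R ω j}).descFactorial r : ℝ≥0∞)
      = ∑ e ∈ {e : Fin r ↪ ι | ∀ k, e k ∈ s},
          Set.indicator {ω | ∀ k, R ω (e k)} (1 : Ω → ℝ≥0∞) ω := by
    intro ω
    rw [← card_embedding_mem]
    simp only [Set.indicator_apply, Set.mem_ofPred_eq, Pi.one_apply, sum_boole, filter_filter,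
      mem_filter, ← forall_and]
  simp_rw [h1]
  rw [lintegral_finsetSum _ fun e _ => measurable_one.indicator (hm e)]
  have h2 : ∀ e ∈ ({e : Fin r ↪ ι | ∀ k, e k ∈ s} : Finset (Fin r ↪ ι)),
      ∫⁻ ω, Set.indicator {ω | ∀ k, R ω (e k)} (1 : Ω → ℝ≥0∞) ω ∂P = p := by
    intro e he
    rw [lintegral_indicator_one (hm e)]
    exact hp e (by simpa using he)
  rw [sum_congr rfl h2, sum_const, card_embedding_mem, nsmul_eq_mul]

open Classical in
lemma measurable_card_filter {Ω ι : Type*} [MeasurableSpace Ω]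
    (R : Ω → ι → Prop) (hR : ∀ j, MeasurableSet {ω | R ω j}) (s : Finset ι) :
    Measurable fun ω => ((#{j ∈ s | R ω j} : ℕ) : ℝ≥0∞) := by
  simp_rw [card_filter, Nat.cast_sum]
  refine Finset.measurable_sum _ fun j _ => ?_
  have : (fun ω => (((if R ω j then 1 else 0 : ℕ)) : ℝ≥0∞))
      = Set.indicator {ω | R ω j} 1 := by
    funext ω
    simp [Set.indicator_apply]
  rw [this]
  exact measurable_one.indicator (hR j)

-- The count has mean #s · p and fourth factorial moment (#s)₄ · q. In the application D dominates
-- the corresponding moments for n + 3 candidates, so both are at most #s / n times D, and 92 = 81 +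
-- 11.
open Classical in
lemma mul_lintegral_card_pow_four_le {Ω : Type*} [MeasurableSpace Ω] (P : Measure Ω) {n : ℕ}
    (R : Ω → Fin n → Prop) (hR : ∀ j, MeasurableSet {ω | R ω j}) (s : Finset (Fin n))
    {b : ℕ} (hb : #s ≤ b) {p q D : ℝ≥0∞}
    (hp : ∀ j ∈ s, P {ω | R ω j} = p)
    (hq : ∀ e : Fin 4 ↪ Fin n, (∀ k, e k ∈ s) → P {ω | ∀ k, R ω (e k)} = q)
    (hpD : (n + 3 : ℕ) * p ≤ D) (hqD : ((n + 3).descFactorial 4 : ℕ) * q ≤ D) :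
    n * ∫⁻ ω, ((#{j ∈ s | R ω j} : ℕ) : ℝ≥0∞) ^ 4 ∂P ≤ 92 * b * D := by
  have hsn : #s ≤ n := card_finset_fin_le s
  have h1 : ∫⁻ ω, ((#{j ∈ s | R ω j} : ℕ) : ℝ≥0∞) ∂P = #s * p := by
    have := lintegral_card_descFactorial P R hR s 1 p fun e he => by
      simpa [Fin.forall_fin_one] using hp (e 0) (he 0)
    simpa using this
  have h4 := lintegral_card_descFactorial P R hR s 4 q hq
  have hm := measurable_card_filter R hR s
  calc (n : ℝ≥0∞) * ∫⁻ ω, ((#{j ∈ s | R ω j} : ℕ) : ℝ≥0∞) ^ 4 ∂P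
      ≤ n * ∫⁻ ω, (81 * ((#{j ∈ s | R ω j} : ℕ) : ℝ≥0∞)
          + 11 * ((#{j ∈ s | R ω j}).descFactorial 4 : ℕ)) ∂P := by
        gcongr with ω
        exact_mod_cast pow_four_le_descFactorial _
    _ = n * (81 * (#s * p) + 11 * ((#s).descFactorial 4 * q)) := by
        rw [lintegral_add_left (hm.const_mul _), lintegral_const_mul _ hm,
          lintegral_const_mul' _ _ (by simp), h1, h4]
    _ = 81 * (#s * (n * p)) + 11 * ((n * (#s).descFactorial 4 : ℕ) * q) := by
        push_cast
        ring
    _ ≤ 81 * (b * ((n + 3 : ℕ) * p)) + 11 * ((b * (n + 3).descFactorial 4 : ℕ) * q) := by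
        have e1 : n * (#s).descFactorial 4 ≤ b * (n + 3).descFactorial 4 :=
          (mul_descFactorial_four_le hsn).trans
            (Nat.mul_le_mul hb (Nat.descFactorial_le 4 (by omega)))
        gcongr
        omega
    _ ≤ 81 * (b * D) + 11 * (b * D) := by
        rw [Nat.cast_mul, mul_assoc (b : ℝ≥0∞)]
        gcongr
    _ = 92 * b * D := by ring

end Counting

/-! ### Edge probabilities and neighbour counts -/

section Graph

variable {𝒳 : Type*}

/-- The event that the vertex `c 0` is joined to all vertices `c 1, …, c r`. -/
def starEvent {m r : ℕ} (G : GraphicalRule 𝒳 m) (c : Fin (r + 1) → Fin m) : Set (Fin m → 𝒳) :=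
  {y | ∀ k : Fin r, (G y).Adj (c 0) (c k.succ)}

lemma adj_iff_castAdd {n : ℕ} {G : GraphicalRule 𝒳 n} {G' : GraphicalRule 𝒳 (n + 4)}
    (hext : G'.IsExtension G) (y : Fin (n + 4) → 𝒳) (i j : Fin n) :
    (G (y ∘ Fin.castAdd 4)).Adj i j ↔ (G' y).Adj (Fin.castAdd 4 i) (Fin.castAdd 4 j) :=
  hext (Fin.castAddEmb 4) _ y (fun _ => rfl) i j

variable [MeasurableSpace 𝒳] (μ : Measure 𝒳) [IsProbabilityMeasure μ]

lemma measurableSet_starEvent {m r : ℕ} {G : GraphicalRule 𝒳 m}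
    (hG : ∀ i j, MeasurableSet {y | (G y).Adj i j}) (c : Fin (r + 1) → Fin m) :
    MeasurableSet (starEvent G c) := by
  rw [starEvent, Set.ofPred_forall]
  exact MeasurableSet.iInter fun k => hG _ _

/-- Some permutation of the vertices carries one tuple of distinct vertices to the other; it
preserves the product law and, by symmetry of the rule, maps star events to star events. -/
lemma measure_starEvent_eq {m r : ℕ} {G : GraphicalRule 𝒳 m} (hsymm : G.IsSymmetric)
    (hG : ∀ i j, MeasurableSet {y | (G y).Adj i j}) (c d : Fin (r + 1) ↪ Fin m) :
    iid μ (Fin m) (starEvent G c) = iid μ (Fin m) (starEvent G d) := by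
  have := Equiv.Perm.isMultiplyPretransitive (Fin m) (r + 1)
  obtain ⟨σ, hσ⟩ := MulAction.exists_smul_eq (Equiv.Perm (Fin m)) c d
  have hmap : ∀ k, σ (c k) = d k := fun k => by
    rw [← hσ]
    rfl
  rw [← (measurePreserving_comp_injective μ σ.injective).measure_preimage
    (measurableSet_starEvent hG c).nullMeasurableSet]
  congr 1
  ext y
  simp only [starEvent, Set.mem_preimage, Set.mem_ofPred_eq, hsymm σ y, hmap]

/-- The probability that the vertex `0` is joined to the vertices `1, …, r`, for `r < m`. -/
noncomputable def starProb {m : ℕ} (G : GraphicalRule 𝒳 m) (r : ℕ) (hr : r + 1 ≤ m) : ℝ≥0∞ :=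
  iid μ (Fin m) (starEvent G (Fin.castLE hr))

lemma measure_starEvent {m r : ℕ} {G : GraphicalRule 𝒳 m} (hsymm : G.IsSymmetric)
    (hG : ∀ i j, MeasurableSet {y | (G y).Adj i j}) (hr : r + 1 ≤ m)
    {c : Fin (r + 1) → Fin m} (hc : Function.Injective c) :
    iid μ (Fin m) (starEvent G c) = starProb μ G r hr :=
  measure_starEvent_eq μ hsymm hG ⟨c, hc⟩ ⟨Fin.castLE hr, Fin.castLE_injective hr⟩

lemma measure_forall_adj {m r : ℕ} {G : GraphicalRule 𝒳 m} (hsymm : G.IsSymmetric)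
    (hG : ∀ i j, MeasurableSet {y | (G y).Adj i j}) (hr : r + 1 ≤ m)
    {i : Fin m} {e : Fin r → Fin m} (he : Function.Injective e) (hi : ∀ k, e k ≠ i) :
    iid μ (Fin m) {y | ∀ k, (G y).Adj i (e k)} = starProb μ G r hr := by
  have hc : Function.Injective (Fin.cons i e : Fin (r + 1) → Fin m) := by
    rw [Fin.cons_injective_iff]
    exact ⟨by rintro ⟨k, hk⟩; exact hi k hk, he⟩
  rw [← measure_starEvent μ hsymm hG hr hc]
  simp [starEvent]

open Classical in
lemma onePlusDegree_eq {m : ℕ} (H : SimpleGraph (Fin m)) (v : Fin m) :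
    onePlusDegree H v = 1 + Finset.card {j ∈ Finset.univ.erase v | H.Adj v j} := by
  rw [onePlusDegree, ← SimpleGraph.card_neighborFinset_eq_degree]
  congr 2
  ext j
  simp only [SimpleGraph.mem_neighborFinset, Finset.mem_filter, Finset.mem_erase, Finset.mem_univ,
    and_true]
  exact ⟨fun h => ⟨h.ne', h⟩, fun h => h.2⟩

lemma one_le_lintegral_onePlusDegree {m : ℕ} (G : GraphicalRule 𝒳 m) (v : Fin m) :
    1 ≤ ∫⁻ y, (onePlusDegree (G y) v : ℝ≥0∞) ^ 4 ∂iid μ (Fin m) := by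
  calc (1 : ℝ≥0∞) = ∫⁻ _y, 1 ∂iid μ (Fin m) := by simp
    _ ≤ _ := by
      refine lintegral_mono fun y => one_le_pow₀ ?_
      rw [onePlusDegree]
      exact_mod_cast Nat.le_add_right 1 _

lemma lintegral_onePlusDegree_lt_top {m : ℕ} (G : GraphicalRule 𝒳 m) (v : Fin m) :
    ∫⁻ y, (onePlusDegree (G y) v : ℝ≥0∞) ^ 4 ∂iid μ (Fin m) < ∞ := by
  calc _ ≤ ∫⁻ _y, ((1 + m : ℕ) : ℝ≥0∞) ^ 4 ∂iid μ (Fin m) := by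
        refine lintegral_mono fun y => ?_
        have : onePlusDegree (G y) v ≤ 1 + m := by
          classical
          rw [onePlusDegree_eq]
          gcongr
          exact (Finset.card_le_univ _).trans_eq (Fintype.card_fin m)
        gcongr
    _ < ∞ := by
      simp only [lintegral_const, measure_univ, mul_one]
      exact ENNReal.pow_lt_top (ENNReal.natCast_lt_top _)

lemma measurable_onePlusDegree {m : ℕ} {G : GraphicalRule 𝒳 m}
    (hG : ∀ i j, MeasurableSet {y | (G y).Adj i j}) (v : Fin m) :
    Measurable fun y => (onePlusDegree (G y) v : ℝ≥0∞) := by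
  classical
  simp_rw [onePlusDegree_eq, Nat.cast_add]
  exact (measurable_card_filter _ (hG v) _).const_add _

/-- The left side is the r-th factorial moment of the degree d of vertex 0, which has n + 3 possible
neighbours, and (d)_r ≤ (1 + d)⁴. -/
lemma descFactorial_mul_starProb_le {n r : ℕ} (hr : r ≤ 4) {G' : GraphicalRule 𝒳 (n + 4)}
    (hsymm : G'.IsSymmetric) (hG' : ∀ i j, MeasurableSet {y | (G' y).Adj i j})
    (hr' : r + 1 ≤ n + 4) :
    ((n + 3).descFactorial r : ℕ) * starProb μ G' r hr'
      ≤ ∫⁻ y, (onePlusDegree (G' y) 0 : ℝ≥0∞) ^ 4 ∂iid μ (Fin (n + 4)) := by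
  classical
  have h := lintegral_card_descFactorial (iid μ (Fin (n + 4)))
    (fun y j => (G' y).Adj 0 j) (hG' 0) (Finset.univ.erase 0) r (starProb μ G' r hr')
    fun e he => measure_forall_adj μ hsymm hG' hr' e.injective fun k =>
      (Finset.mem_erase.1 (he k)).1
  rw [Finset.card_erase_of_mem (Finset.mem_univ _), Finset.card_univ, Fintype.card_fin,
    show n + 4 - 1 = n + 3 from rfl] at h
  rw [← h]
  refine lintegral_mono fun y => ?_
  rw [onePlusDegree_eq]
  norm_cast
  set d := Finset.card {j ∈ Finset.univ.erase (0 : Fin (n + 4)) | (G' y).Adj 0 j}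
  refine Nat.cast_le.2 ?_
  calc d.descFactorial r ≤ d ^ r := Nat.descFactorial_le_pow d r
    _ ≤ (1 + d) ^ r := Nat.pow_le_pow_left (by omega) r
    _ ≤ (1 + d) ^ 4 := Nat.pow_le_pow_right (by omega) hr

variable {n : ℕ} {G : GraphicalRule 𝒳 n} {G' : GraphicalRule 𝒳 (n + 4)}

/-- Padding x with four copies of its own coordinate x_i is a measurable map into the larger space,
and the extension property identifies the edges of G with edges of G' there. -/
lemma measurableSet_adj (hext : G'.IsExtension G)
    (hG' : ∀ i j, MeasurableSet {y | (G' y).Adj i j}) (i j : Fin n) :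
    MeasurableSet {x | (G x).Adj i j} := by
  have hm : Measurable fun x : Fin n → 𝒳 => Fin.append x fun _ : Fin 4 => x i := by
    refine measurable_pi_lambda _ fun k => ?_
    refine Fin.addCases (fun k => ?_) (fun k => ?_) k
    · simp only [Fin.append_left]
      fun_prop
    · simp only [Fin.append_right]
      fun_prop
  convert hm (hG' (Fin.castAdd 4 i) (Fin.castAdd 4 j)) using 1
  ext x
  simp only [Set.mem_preimage, Set.mem_ofPred_eq]
  rw [← adj_iff_castAdd hext]
  have : (Fin.append x fun _ : Fin 4 => x i) ∘ Fin.castAdd 4 = x := by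
    funext k
    simp
  rw [this]

lemma measure_forall_adj_of_extension (hsymm : G'.IsSymmetric) (hext : G'.IsExtension G)
    (hG' : ∀ i j, MeasurableSet {y | (G' y).Adj i j}) {r : ℕ} (hr : r + 1 ≤ n + 4)
    {i : Fin n} {e : Fin r → Fin n} (he : Function.Injective e) (hi : ∀ k, e k ≠ i) :
    iid μ (Fin n) {x | ∀ k, (G x).Adj i (e k)} = starProb μ G' r hr := by
  have hinj := Fin.castAdd_injective n 4
  have hm : MeasurableSet {x | ∀ k, (G x).Adj i (e k)} := by
    rw [Set.ofPred_forall]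
    exact MeasurableSet.iInter fun k => measurableSet_adj hext hG' _ _
  rw [← (measurePreserving_comp_injective μ hinj).measure_preimage hm.nullMeasurableSet,
    ← measure_forall_adj μ hsymm hG' hr (hinj.comp he) (i := Fin.castAdd 4 i)
      fun k h => hi k (hinj h)]
  congr 1
  ext y
  simp [adj_iff_castAdd hext]

/-- The four graphs have different replaced coordinates, so no single graph on n vertices sees them
all. In G' on X₁, …, X_n together with the four replacements, the event says that i is joined to the
four extra vertices, which is again a star event. -/
lemma measure_forall_adj_replace (hsymm : G'.IsSymmetric) (hext : G'.IsExtension G)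
    (hG' : ∀ i j, MeasurableSet {y | (G' y).Adj i j}) {i : Fin n} {e : Fin 4 → Fin n}
    (he : Function.Injective e) (hi : ∀ k, e k ≠ i) (hn : 4 + 1 ≤ n + 4) :
    iidPair μ n {p | ∀ k, (G (replace p.1 p.2 (e k))).Adj i (e k)}
      = starProb μ G' 4 hn := by
  -- Lists X in the first n places and X'_{e 0}, …, X'_{e 3} in the last four.
  set d : Fin (n + 4) → Fin n ⊕ Fin n := Sum.map id e ∘ finSumFinEquiv.symm with hd
  have hdi : Function.Injective d :=
    (Sum.map_injective.2 ⟨Function.injective_id, he⟩).comp finSumFinEquiv.symm.injective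
  have hm : MeasurableSet {y : Fin (n + 4) → 𝒳 |
      ∀ k : Fin 4, (G' y).Adj (Fin.castAdd 4 i) (Fin.natAdd n k)} := by
    rw [Set.ofPred_forall]
    exact MeasurableSet.iInter fun k => hG' _ _
  have hne : ∀ (a : Fin n) (b : Fin 4), Fin.natAdd n b ≠ Fin.castAdd 4 a := fun a b h => by
    have := congrArg Fin.val h
    simp at this
    omega
  rw [← measure_forall_adj μ hsymm hG' hn (Fin.natAdd_injective 4 n)
    (i := Fin.castAdd 4 i) fun k => hne i k,
    ← (measurePreserving_sumElim_comp μ hdi).measure_preimage hm.nullMeasurableSet]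
  congr 1
  ext p
  simp only [Set.mem_preimage, Set.mem_ofPred_eq]
  refine forall_congr' fun k => ?_
  -- Redirecting the index e k to the k-th extra place exhibits X^{e k} as a subvector of the long
  -- vector.
  let u : Fin n ↪ Fin (n + 4) :=
    ⟨fun m => if m = e k then Fin.natAdd n k else Fin.castAdd 4 m, by
      intro a b h
      simp only at h
      split_ifs at h with h1 h2 h2
      · rw [h1, h2]
      · exact absurd h (hne _ _)
      · exact absurd h.symm (hne _ _)
      · exact Fin.castAdd_injective n 4 h⟩
  have e1 : ∀ m, m ≠ e k → u m = Fin.castAdd 4 m := fun m hm => if_neg hm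
  have e2 : u (e k) = Fin.natAdd n k := if_pos rfl
  have h := hext u (replace p.1 p.2 (e k)) (Sum.elim p.1 p.2 ∘ d) (fun m => by
    rcases eq_or_ne m (e k) with rfl | hmk
    · rw [e2]
      simp [replace, hd]
    · rw [e1 m hmk]
      simp [replace, hd, hmk]) i (e k)
  rw [h, e1 i (hi k).symm, e2]

lemma measure_adj_replace (hsymm : G'.IsSymmetric) (hext : G'.IsExtension G)
    (hG' : ∀ i j, MeasurableSet {y | (G' y).Adj i j}) {i j : Fin n} (hij : j ≠ i) :
    iidPair μ n {p | (G (replace p.1 p.2 j)).Adj i j} = starProb μ G' 1 (by omega) := by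
  rw [← measure_forall_adj_of_extension μ hsymm hext hG' (by omega)
    (i := i) (e := fun _ : Fin 1 => j) (Function.injective_of_subsingleton _) fun _ => hij]
  simp only [forall_const]
  exact (measurePreserving_replace μ j).measure_preimage
    (measurableSet_adj hext hG' i j).nullMeasurableSet

open Classical in
/-- The number of vertices `j ∈ B` joined to `i` in `G x`, or in the graph obtained after the
`j`-th coordinate is replaced, each with multiplicity. -/
noncomputable def neighborCount (G : GraphicalRule 𝒳 n) (B : Finset (Fin n)) (i : Fin n)
    (p : (Fin n → 𝒳) × (Fin n → 𝒳)) : ℕ :=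
  Finset.card {j ∈ B.erase i | (G p.1).Adj i j} +
    Finset.card {j ∈ B.erase i | (G (replace p.1 p.2 j)).Adj i j}

lemma measurable_neighborCount (hext : G'.IsExtension G)
    (hG' : ∀ i j, MeasurableSet {y | (G' y).Adj i j}) (B : Finset (Fin n)) (i : Fin n) :
    Measurable fun p => (neighborCount G B i p : ℝ≥0∞) := by
  simp only [neighborCount, Nat.cast_add]
  exact (measurable_card_filter _ (fun j => measurable_fst (measurableSet_adj hext hG' i j)) _).add
    (measurable_card_filter _
      (fun j => measurable_replace j (measurableSet_adj hext hG' i j)) _)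

/-- Both counts in `neighborCount` have the same probabilities of single and fourfold occurrence,
namely star probabilities of G'. With (a + b)⁴ ≤ 8 (a⁴ + b⁴) the constant is 1472 = 2 · 8 · 92. -/
lemma mul_lintegral_neighborCount_le (hsymm : G'.IsSymmetric) (hext : G'.IsExtension G)
    (hG' : ∀ i j, MeasurableSet {y | (G' y).Adj i j}) (B : Finset (Fin n)) (i : Fin n) :
    n * ∫⁻ p, (neighborCount G B i p : ℝ≥0∞) ^ 4 ∂iidPair μ n
      ≤ 1472 * B.card * ∫⁻ y, (onePlusDegree (G' y) 0 : ℝ≥0∞) ^ 4 ∂iid μ (Fin (n + 4)) := by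
  classical
  have hn : 4 + 1 ≤ n + 4 := by
    have := i.pos
    omega
  set D := ∫⁻ y, (onePlusDegree (G' y) 0 : ℝ≥0∞) ^ 4 ∂iid μ (Fin (n + 4))
  have hm : ∀ i j, MeasurableSet {x | (G x).Adj i j} := measurableSet_adj hext hG'
  have hD1 : ((n + 3 : ℕ) : ℝ≥0∞) * starProb μ G' 1 (by omega) ≤ D := by
    simpa using descFactorial_mul_starProb_le μ (by norm_num : 1 ≤ 4) hsymm hG'
      (by omega : 1 + 1 ≤ n + 4)
  have hD4 := descFactorial_mul_starProb_le μ le_rfl hsymm hG' hn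
  have hcard : (B.erase i).card ≤ B.card := Finset.card_erase_le
  have hm1 : ∀ j, MeasurableSet {p : (Fin n → 𝒳) × (Fin n → 𝒳) | (G p.1).Adj i j} :=
    fun j => measurable_fst (hm i j)
  have hm2 : ∀ j, MeasurableSet
      {p : (Fin n → 𝒳) × (Fin n → 𝒳) | (G (replace p.1 p.2 j)).Adj i j} :=
    fun j => measurable_replace j (hm i j)
  have h1 := mul_lintegral_card_pow_four_le (iidPair μ n) (fun p j => (G p.1).Adj i j) hm1
    (B.erase i) hcard (p := starProb μ G' 1 (by omega)) (q := starProb μ G' 4 hn)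
    (fun j hj => by
      rw [← measure_forall_adj_of_extension μ hsymm hext hG' (by omega)
        (i := i) (e := fun _ : Fin 1 => j) (Function.injective_of_subsingleton _)
        fun _ => (Finset.mem_erase.1 hj).1]
      simp only [forall_const]
      exact (measurePreserving_fst (μ := iid μ (Fin n)) (ν := iid μ (Fin n))).measure_preimage
        (hm i j).nullMeasurableSet)
    (fun e he => by
      rw [← measure_forall_adj_of_extension μ hsymm hext hG' hn
        (i := i) e.injective fun k => (Finset.mem_erase.1 (he k)).1]
      refine (measurePreserving_fst (μ := iid μ (Fin n)) (ν := iid μ (Fin n))).measure_preimage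
        (s := {x | ∀ k, (G x).Adj i (e k)}) (MeasurableSet.nullMeasurableSet ?_)
      rw [Set.ofPred_forall]
      exact MeasurableSet.iInter fun k => hm _ _) hD1 hD4
  have h2 := mul_lintegral_card_pow_four_le (iidPair μ n)
    (fun p j => (G (replace p.1 p.2 j)).Adj i j) hm2
    (B.erase i) hcard (p := starProb μ G' 1 (by omega)) (q := starProb μ G' 4 hn)
    (fun j hj => measure_adj_replace μ hsymm hext hG' (Finset.mem_erase.1 hj).1)
    (fun e he => measure_forall_adj_replace μ hsymm hext hG' e.injective
      (fun k => (Finset.mem_erase.1 (he k)).1) hn) hD1 hD4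
  have hM1 := measurable_card_filter _ hm1 (B.erase i)
  calc _ ≤ n * ∫⁻ p : (Fin n → 𝒳) × (Fin n → 𝒳),
        (8 * ((Finset.card {j ∈ B.erase i | (G p.1).Adj i j} : ℕ) : ℝ≥0∞) ^ 4
        + 8 * ((Finset.card {j ∈ B.erase i | (G (replace p.1 p.2 j)).Adj i j} : ℕ) : ℝ≥0∞) ^ 4)
          ∂iidPair μ n := by
        gcongr with p
        rw [← mul_add]
        exact_mod_cast add_pow_le (Nat.zero_le _) (Nat.zero_le _) 4
    _ = 8 * (n * ∫⁻ p : (Fin n → 𝒳) × (Fin n → 𝒳),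
          ((Finset.card {j ∈ B.erase i | (G p.1).Adj i j} : ℕ) : ℝ≥0∞) ^ 4 ∂iidPair μ n)
        + 8 * (n * ∫⁻ p : (Fin n → 𝒳) × (Fin n → 𝒳),
          ((Finset.card {j ∈ B.erase i | (G (replace p.1 p.2 j)).Adj i j} : ℕ) : ℝ≥0∞) ^ 4
            ∂iidPair μ n) := by
        rw [lintegral_add_left ((hM1.pow_const 4).const_mul 8),
          lintegral_const_mul' _ _ (by simp), lintegral_const_mul' _ _ (by simp)]
        ring
    _ ≤ 8 * (92 * B.card * D) + 8 * (92 * B.card * D) := by gcongr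
    _ = 1472 * B.card * D := by ring

end Graph

end NormalApprox

namespace NormalApprox

/-! ### Hölder inequalities for extended nonnegative reals -/

lemma sum_pow_four_le {ι : Type*} (s : Finset ι) (a : ι → ℝ≥0∞) :
    (∑ i ∈ s, a i) ^ 4 ≤ (s.card : ℝ≥0∞) ^ 3 * ∑ i ∈ s, a i ^ 4 := by
  have h := ENNReal.rpow_sum_le_const_mul_sum_rpow s a (p := 4) (by norm_num)
  rw [show (4 : ℝ) - 1 = (3 : ℕ) by norm_num, show (4 : ℝ) = (4 : ℕ) by norm_num] at h
  simpa only [ENNReal.rpow_natCast] using h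

lemma lintegral_mul_sq_le {α : Type*} [MeasurableSpace α] (ν : Measure α) {u v : α → ℝ≥0∞}
    (hu : Measurable u) (hv : Measurable v) :
    ∫⁻ a, (u a * v a) ^ 2 ∂ν
      ≤ (∫⁻ a, u a ^ 4 ∂ν) ^ (1 / 2 : ℝ) * (∫⁻ a, v a ^ 4 ∂ν) ^ (1 / 2 : ℝ) := by
  have h := ENNReal.lintegral_mul_le_Lp_mul_Lq ν Real.HolderConjugate.two_two
    (hu.pow_const 2).aemeasurable (hv.pow_const 2).aemeasurable
  have e : ∀ x : ℝ≥0∞, (x ^ 2) ^ (2 : ℝ) = x ^ 4 := fun x => by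
    rw [show (2 : ℝ) = (2 : ℕ) by norm_num, ENNReal.rpow_natCast, ← pow_mul]
  simp only [e, Pi.mul_apply, ← mul_pow] at h
  exact h

lemma sum_rpow_half_le {n : ℕ} (x : Fin n → ℝ≥0∞) :
    ∑ i, x i ^ (1 / 2 : ℝ) ≤ (n * ∑ i, x i) ^ (1 / 2 : ℝ) := by
  have h := ENNReal.inner_le_Lp_mul_Lq Finset.univ (fun _ : Fin n => (1 : ℝ≥0∞))
    (fun i => x i ^ (1 / 2 : ℝ)) Real.HolderConjugate.two_two
  have e : ∀ y : ℝ≥0∞, (y ^ (1 / 2 : ℝ)) ^ (2 : ℝ) = y := fun y => by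
    rw [← ENNReal.rpow_mul]
    norm_num
  simp only [one_mul, e, ENNReal.one_rpow, Finset.sum_const, Finset.card_univ, Fintype.card_fin,
    nsmul_eq_mul, mul_one] at h
  rwa [← ENNReal.mul_rpow_of_nonneg _ _ (by norm_num)] at h

/-! ### Effect of resampling one coordinate -/

section Deterministic

variable {𝒳 : Type*} {n : ℕ} {G : GraphicalRule 𝒳 n} {f : (Fin n → 𝒳) → ℝ}

/-- The number of graphs among `G x` and `G xʲ` in which `i` and `j` are joined. -/
noncomputable def edgeCount (G : GraphicalRule 𝒳 n) (i j : Fin n)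
    (p : (Fin n → 𝒳) × (Fin n → 𝒳)) : ℝ≥0∞ :=
  open Classical in
  (if (G p.1).Adj i j then 1 else 0) + if (G (replace p.1 p.2 j)).Adj i j then 1 else 0

lemma neighborCount_eq_sum (B : Finset (Fin n)) (i : Fin n)
    (p : (Fin n → 𝒳) × (Fin n → 𝒳)) :
    (neighborCount G B i p : ℝ≥0∞) = ∑ j ∈ B.erase i, edgeCount G i j p := by
  simp [neighborCount, edgeCount, Finset.sum_add_distrib]

/-- When the first vectors differ only at i, the four graphs in the interaction rule are exactly
those counted by `edgeCount` at p and at q. -/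
lemma pairDelta_eq_of_edgeCount (hG : G.IsInteractionRule f)
    {p q : (Fin n → 𝒳) × (Fin n → 𝒳)} {i j : Fin n} (hij : j ≠ i)
    (hpq1 : ∀ k, k ≠ i → p.1 k = q.1 k) (hpq2 : p.2 j = q.2 j)
    (hp : edgeCount G i j p = 0) (hq : edgeCount G i j q = 0) :
    pairDelta f j p = pairDelta f j q := by
  -- With z as the replacement vector and x = p.1, the vector xⁱ is q.1, while the j-th replacements
  -- are those of p and q.
  set z := Function.update p.2 i (q.1 i) with hz
  have h1 : replace p.1 z i = q.1 := by
    funext k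
    rcases eq_or_ne k i with rfl | hk
    · simp [replace, hz]
    · simp [replace, hk, hpq1]
  have h2 : replace p.1 z j = replace p.1 p.2 j := by
    simp [replace, hz, hij]
  have h3 : replace q.1 z j = replace q.1 q.2 j := by
    simp [replace, hz, hij, hpq2]
  have h := hG p.1 z i j hij.symm
  rw [h1, h2, h3, Noninteracting, h1, h2, h3] at h
  simp only [edgeCount, add_eq_zero, ite_eq_right_iff, one_ne_zero, imp_false] at hp hq
  exact h hp.1 hq.1 hp.2 hq.2

lemma one_le_edgeCount {i j : Fin n} {p : (Fin n → 𝒳) × (Fin n → 𝒳)}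
    (h : edgeCount G i j p ≠ 0) : 1 ≤ edgeCount G i j p := by
  classical
  unfold edgeCount at h ⊢
  split_ifs at h ⊢ <;> simp_all

/-- The largest randomized derivative. -/
noncomputable def maxDelta (f : (Fin n → 𝒳) → ℝ) (p : (Fin n → 𝒳) × (Fin n → 𝒳)) : ℝ≥0∞ :=
  ⨆ j, ‖delta f p.1 p.2 j‖ₑ

lemma enorm_pairDelta_le (j : Fin n) (p : (Fin n → 𝒳) × (Fin n → 𝒳)) :
    ‖pairDelta f j p‖ₑ ≤ maxDelta f p :=
  le_iSup (fun j => ‖delta f p.1 p.2 j‖ₑ) j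

/-- The sum of the products of the randomized derivatives along `j ∉ A` at `X` and at `X^A`. -/
def prodSum (f : (Fin n → 𝒳) → ℝ) (A : Finset (Fin n))
    (p : (Fin n → 𝒳) × (Fin n → 𝒳)) : ℝ :=
  ∑ j ∈ Aᶜ, pairDelta f j p * pairDelta f j (swapOn A p)

/-- The pairs at which randomized derivatives are taken, when the `i`-th coordinate of `x` is
replaced by that of `y`, for `q = ((x, y), x')`. -/
def perturbed (A : Finset (Fin n)) (i : Fin n) :
    Fin 4 → ((Fin n → 𝒳) × (Fin n → 𝒳)) × (Fin n → 𝒳) → (Fin n → 𝒳) × (Fin n → 𝒳) :=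
  ![fun q => (q.1.1, q.2), fun q => (replace q.1.1 q.1.2 i, q.2),
    fun q => swapOn A (q.1.1, q.2), fun q => swapOn A (replace q.1.1 q.1.2 i, q.2)]

lemma enorm_mul_sub_mul_le (a b c d : ℝ) {w x y z : ℝ≥0∞} (ha : ‖a‖ₑ ≤ w) (hb : ‖b‖ₑ ≤ y)
    (hc : ‖c‖ₑ ≤ x) (hd : ‖d‖ₑ ≤ z) :
    ‖a * b - c * d‖ₑ ≤ w ^ 2 + x ^ 2 + y ^ 2 + z ^ 2 := by
  have key : ∀ s t : ℝ≥0∞, s * t ≤ s ^ 2 + t ^ 2 := fun s t => by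
    rcases le_total s t with h | h
    · calc s * t ≤ t * t := by gcongr
        _ ≤ _ := by rw [pow_two t]; exact le_add_self
    · calc s * t ≤ s * s := by gcongr
        _ ≤ _ := by rw [pow_two s]; exact le_self_add
  calc ‖a * b - c * d‖ₑ ≤ ‖a * b‖ₑ + ‖c * d‖ₑ := enorm_sub_le
    _ = ‖a‖ₑ * ‖b‖ₑ + ‖c‖ₑ * ‖d‖ₑ := by rw [enorm_mul, enorm_mul]
    _ ≤ w * y + x * z := by gcongr
    _ ≤ (w ^ 2 + y ^ 2) + (x ^ 2 + z ^ 2) := add_le_add (key _ _) (key _ _)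
    _ = _ := by ring

-- A summand j ≠ i changes only if i and j are joined in a graph attached to one of the four
-- perturbed pairs, and then an edge count is at least 1. The summand j = i may always change, hence
-- the indicator. Each change is at most the sum of the squared maximal derivatives.
open Classical in
lemma enorm_prodSum_sub_le (hG : G.IsInteractionRule f) (A : Finset (Fin n)) (i : Fin n)
    (q : ((Fin n → 𝒳) × (Fin n → 𝒳)) × (Fin n → 𝒳)) :
    ‖prodSum f A (q.1.1, q.2) - prodSum f A (replace q.1.1 q.1.2 i, q.2)‖ₑ
      ≤ (∑ l, maxDelta f (perturbed A i l q) ^ 2)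
        * ((if i ∈ Aᶜ then 1 else 0) + ∑ l, (neighborCount G Aᶜ i (perturbed A i l q) : ℝ≥0∞)) := by
  set R := ∑ l, maxDelta f (perturbed A i l q) ^ 2 with hR
  set p1 := (q.1.1, q.2) with hp1
  set p2 := (replace q.1.1 q.1.2 i, q.2) with hp2
  set t : Fin n → ℝ := fun j => pairDelta f j p1 * pairDelta f j (swapOn A p1)
    - pairDelta f j p2 * pairDelta f j (swapOn A p2) with ht
  have htR : ∀ j, ‖t j‖ₑ ≤ R := by
    intro j
    refine (enorm_mul_sub_mul_le _ _ _ _ (enorm_pairDelta_le j _) (enorm_pairDelta_le j _)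
      (enorm_pairDelta_le j _) (enorm_pairDelta_le j _)).trans (le_of_eq ?_)
    rw [hR, Fin.sum_univ_four]
    rfl
  have h12 : ∀ k, k ≠ i → p1.1 k = p2.1 k := fun k hk => by simp [hp1, hp2, replace, hk]
  have htj : ∀ j ∈ Aᶜ.erase i, ‖t j‖ₑ ≤ R * ∑ l, edgeCount G i j (perturbed A i l q) := by
    intro j hj
    have hji : j ≠ i := (Finset.mem_erase.1 hj).1
    by_cases hs : ∑ l, edgeCount G i j (perturbed A i l q) = 0
    · rw [Finset.sum_eq_zero_iff] at hs
      have e1 : pairDelta f j p1 = pairDelta f j p2 :=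
        pairDelta_eq_of_edgeCount hG hji h12 rfl (hs 0 (Finset.mem_univ _))
          (hs 1 (Finset.mem_univ _))
      have e2 : pairDelta f j (swapOn A p1) = pairDelta f j (swapOn A p2) := by
        refine pairDelta_eq_of_edgeCount hG hji (fun k hk => ?_) ?_ (hs 2 (Finset.mem_univ _))
          (hs 3 (Finset.mem_univ _))
        · simp only [swapOn, mix, h12 k hk]
          rfl
        · simp only [swapOn, mix, h12 j hji]
          rfl
      simp [ht, e1, e2]
    · have h1 : 1 ≤ ∑ l, edgeCount G i j (perturbed A i l q) := by
        rw [Finset.sum_eq_zero_iff] at hs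
        push Not at hs
        obtain ⟨l, hl, hl'⟩ := hs
        exact (one_le_edgeCount hl').trans
          (Finset.single_le_sum (f := fun l => edgeCount G i j (perturbed A i l q))
            (fun _ _ => zero_le) hl)
      calc ‖t j‖ₑ ≤ R * 1 := by rw [mul_one]; exact htR j
        _ ≤ _ := by gcongr
  have hsum : prodSum f A p1 - prodSum f A p2 = ∑ j ∈ Aᶜ, t j := by
    rw [prodSum, prodSum, ← Finset.sum_sub_distrib]
  calc ‖prodSum f A p1 - prodSum f A p2‖ₑ ≤ ∑ j ∈ Aᶜ, ‖t j‖ₑ := by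
        rw [hsum]
        exact enorm_sum_le _ _
    _ ≤ (if i ∈ Aᶜ then ‖t i‖ₑ else 0) + ∑ j ∈ Aᶜ.erase i, ‖t j‖ₑ := by
        split_ifs with h
        · rw [Finset.add_sum_erase _ (fun j => ‖t j‖ₑ) h]
        · rw [Finset.erase_eq_of_notMem h, zero_add]
    _ ≤ (if i ∈ Aᶜ then R else 0)
          + ∑ j ∈ Aᶜ.erase i, R * ∑ l, edgeCount G i j (perturbed A i l q) := by
        refine add_le_add ?_ (Finset.sum_le_sum htj)
        split_ifs
        · exact htR i
        · exact le_rfl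
    _ = _ := by
        simp_rw [neighborCount_eq_sum]
        rw [Finset.sum_comm (s := Finset.univ), mul_add, Finset.mul_sum]
        simp

end Deterministic

/-! ### Moment bounds for the effect of resampling -/

section Moments

variable {𝒳 : Type*} [MeasurableSpace 𝒳] {μ : Measure 𝒳} [IsProbabilityMeasure μ] {n : ℕ}
  {G : GraphicalRule 𝒳 n} {G' : GraphicalRule 𝒳 (n + 4)} {f : (Fin n → 𝒳) → ℝ}

variable (μ) in
lemma measurePreserving_perturbed (A : Finset (Fin n)) (i : Fin n) (l : Fin 4) :
    MeasurePreserving (perturbed A i l) ((iidPair μ n).prod (iid μ (Fin n))) (iidPair μ n) := by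
  have h0 : MeasurePreserving
      (fun q : ((Fin n → 𝒳) × (Fin n → 𝒳)) × (Fin n → 𝒳) => (q.1.1, q.2))
      ((iidPair μ n).prod (iid μ (Fin n))) (iidPair μ n) :=
    MeasurePreserving.prod
      (measurePreserving_fst (μ := iid μ (Fin n)) (ν := iid μ (Fin n))) (.id _)
  have h1 : MeasurePreserving
      (fun q : ((Fin n → 𝒳) × (Fin n → 𝒳)) × (Fin n → 𝒳) => (replace q.1.1 q.1.2 i, q.2))
      ((iidPair μ n).prod (iid μ (Fin n))) (iidPair μ n) :=
    MeasurePreserving.prod (measurePreserving_replace μ i) (.id _)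
  fin_cases l
  · exact h0
  · exact h1
  · exact (measurePreserving_swapOn μ A).comp h0
  · exact (measurePreserving_swapOn μ A).comp h1

lemma measurable_maxDelta (hf : Measurable f) : Measurable (maxDelta f) :=
  Measurable.iSup fun j => (measurable_pairDelta hf j).enorm

lemma measurable_swapOn (A : Finset (Fin n)) :
    Measurable (swapOn A : (Fin n → 𝒳) × (Fin n → 𝒳) → _) := by
  refine Measurable.prodMk (measurable_pi_lambda _ fun k => ?_)
    (measurable_pi_lambda _ fun k => ?_) <;>
  · simp only [mix]
    split_ifs <;> fun_prop

lemma measurable_prodSum (hf : Measurable f) (A : Finset (Fin n)) : Measurable (prodSum f A) :=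
  Finset.measurable_sum _ fun j _ =>
    (measurable_pairDelta hf j).mul ((measurable_pairDelta hf j).comp (measurable_swapOn A))

-- Cauchy–Schwarz for each i separates R (squared derivatives) from N (neighbour counts), and a
-- second Cauchy–Schwarz over i produces the factor n. All four perturbed pairs have the law of (X,
-- X'), so no moment depends on the perturbation.
open Classical in
lemma sum_lintegral_prodSum_sub_le (hsymm : G'.IsSymmetric) (hext : G'.IsExtension G)
    (hG' : ∀ i j, MeasurableSet {y | (G' y).Adj i j}) (hG : G.IsInteractionRule f)
    (hf : Measurable f) (A : Finset (Fin n)) :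
    ∑ i, ∫⁻ q, ‖prodSum f A (q.1.1, q.2) - prodSum f A (replace q.1.1 q.1.2 i, q.2)‖ₑ ^ 2
        ∂(iidPair μ n).prod (iid μ (Fin n))
      ≤ (256 * ∫⁻ p, maxDelta f p ^ 8 ∂iidPair μ n) ^ (1 / 2 : ℝ)
        * (n * (3014664 * Aᶜ.card
          * ∫⁻ y, (onePlusDegree (G' y) 0 : ℝ≥0∞) ^ 4 ∂iid μ (Fin (n + 4)))) ^ (1 / 2 : ℝ) := by
  set ν := (iidPair μ n).prod (iid μ (Fin n)) with hν
  set D := ∫⁻ y, (onePlusDegree (G' y) 0 : ℝ≥0∞) ^ 4 ∂iid μ (Fin (n + 4)) with hD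
  set K := ∫⁻ p, maxDelta f p ^ 8 ∂iidPair μ n with hK
  have hD1 : 1 ≤ D := one_le_lintegral_onePlusDegree μ G' 0
  set R : Fin n → _ → ℝ≥0∞ := fun i q => ∑ l, maxDelta f (perturbed A i l q) ^ 2 with hR
  set N : Fin n → _ → ℝ≥0∞ := fun i q =>
    (if i ∈ Aᶜ then 1 else 0) + ∑ l, (neighborCount G Aᶜ i (perturbed A i l q) : ℝ≥0∞) with hN
  have hpm : ∀ i l, Measurable (perturbed A i l : _ → (Fin n → 𝒳) × (Fin n → 𝒳)) :=
    fun i l => (measurePreserving_perturbed μ A i l).measurable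
  have hRm : ∀ i, Measurable (R i) := fun i => Finset.measurable_sum _ fun l _ =>
    ((measurable_maxDelta hf).comp (hpm i l)).pow_const 2
  have hnm : ∀ i l, Measurable fun q => (neighborCount G Aᶜ i (perturbed A i l q) : ℝ≥0∞) :=
    fun i l => (measurable_neighborCount hext hG' Aᶜ i).comp (hpm i l)
  have hNm : ∀ i, Measurable (N i) := fun i =>
    (Finset.measurable_sum _ fun l _ => hnm i l).const_add _
  have hR4 : ∀ i, ∫⁻ q, R i q ^ 4 ∂ν ≤ 256 * K := by
    intro i
    calc ∫⁻ q, R i q ^ 4 ∂ν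
        ≤ ∫⁻ q, 64 * ∑ l, maxDelta f (perturbed A i l q) ^ 8 ∂ν := by
          refine lintegral_mono fun q => ?_
          refine (sum_pow_four_le _ _).trans (le_of_eq ?_)
          simp only [← pow_mul]
          norm_num
      _ = 64 * ∑ l, ∫⁻ q, maxDelta f (perturbed A i l q) ^ 8 ∂ν := by
          rw [lintegral_const_mul' _ _ (by simp), lintegral_finsetSum
            (f := fun l q => maxDelta f (perturbed A i l q) ^ 8) _ fun l _ =>
            ((measurable_maxDelta hf).comp (hpm i l)).pow_const 8]
      _ = 64 * ∑ _l : Fin 4, K := by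
          congr 1
          refine Finset.sum_congr rfl fun l _ => ?_
          exact (measurePreserving_perturbed μ A i l).lintegral_comp
            ((measurable_maxDelta hf).pow_const 8)
      _ = 256 * K := by
          simp only [Finset.sum_const, Finset.card_univ, Fintype.card_fin, nsmul_eq_mul]
          rw [← mul_assoc]
          norm_num
  -- The power-mean inequality costs 2³ for two terms and 4³ for the four pairs, which have equal
  -- moments: 2048 = 8 · 64 · 4.
  have hN4 : ∀ i, ∫⁻ q, N i q ^ 4 ∂ν ≤ 8 * (if i ∈ Aᶜ then 1 else 0)
      + 2048 * ∫⁻ p, (neighborCount G Aᶜ i p : ℝ≥0∞) ^ 4 ∂iidPair μ n := by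
    intro i
    calc ∫⁻ q, N i q ^ 4 ∂ν
        ≤ ∫⁻ q, (8 * (if i ∈ Aᶜ then 1 else 0)
            + 512 * ∑ l, (neighborCount G Aᶜ i (perturbed A i l q) : ℝ≥0∞) ^ 4) ∂ν := by
          refine lintegral_mono fun q => ?_
          simp only [hN]
          have h1 := sum_pow_four_le Finset.univ
            ![(if i ∈ Aᶜ then 1 else 0 : ℝ≥0∞),
              ∑ l, (neighborCount G Aᶜ i (perturbed A i l q) : ℝ≥0∞)]
          have h2 := sum_pow_four_le Finset.univ fun l =>
            (neighborCount G Aᶜ i (perturbed A i l q) : ℝ≥0∞)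
          simp only [Fin.sum_univ_two, Matrix.cons_val_zero, Matrix.cons_val_one,
            Finset.card_univ, Fintype.card_fin] at h1 h2
          refine h1.trans ?_
          calc _ ≤ ((2 : ℕ) : ℝ≥0∞) ^ 3 * ((if i ∈ Aᶜ then 1 else 0) ^ 4 + ((4 : ℕ) : ℝ≥0∞) ^ 3 *
                ∑ l, (neighborCount G Aᶜ i (perturbed A i l q) : ℝ≥0∞) ^ 4) := by gcongr
            _ = _ := by
                rw [mul_add, ← mul_assoc]
                congr 2
                · norm_num
                · split_ifs <;> simp
                · norm_num
      _ = 8 * (if i ∈ Aᶜ then 1 else 0)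
            + 512 * ∑ l, ∫⁻ q, (neighborCount G Aᶜ i (perturbed A i l q) : ℝ≥0∞) ^ 4 ∂ν := by
          rw [lintegral_add_left measurable_const, lintegral_const,
            lintegral_const_mul' _ _ (by simp),
            lintegral_finsetSum _ fun l _ => (hnm i l).pow_const 4]
          simp
      _ = 8 * (if i ∈ Aᶜ then 1 else 0)
            + 512 * ∑ _l : Fin 4, ∫⁻ p, (neighborCount G Aᶜ i p : ℝ≥0∞) ^ 4 ∂iidPair μ n := by
          congr 2
          refine Finset.sum_congr rfl fun l _ => ?_
          exact (measurePreserving_perturbed μ A i l).lintegral_comp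
            ((measurable_neighborCount hext hG' Aᶜ i).pow_const 4)
      _ = _ := by
          simp only [Finset.sum_const, Finset.card_univ, Fintype.card_fin, nsmul_eq_mul]
          rw [← mul_assoc 512]
          norm_num
  have hNsum : ∑ i, ∫⁻ q, N i q ^ 4 ∂ν ≤ 3014664 * Aᶜ.card * D := by
    have hc : ∀ i, ∫⁻ p, (neighborCount G Aᶜ i p : ℝ≥0∞) ^ 4 ∂iidPair μ n
        ≤ 1472 * Aᶜ.card * D / n := by
      intro i
      have hn : (n : ℝ≥0∞) ≠ 0 := by exact_mod_cast i.pos.ne'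
      rw [ENNReal.le_div_iff_mul_le (Or.inl hn) (Or.inl (by simp)), mul_comm]
      exact mul_lintegral_neighborCount_le μ hsymm hext hG' Aᶜ i
    calc ∑ i, ∫⁻ q, N i q ^ 4 ∂ν
        ≤ ∑ i : Fin n, (8 * (if i ∈ Aᶜ then 1 else 0) + 2048 * (1472 * Aᶜ.card * D / n)) :=
          Finset.sum_le_sum fun i _ => (hN4 i).trans (by gcongr; exact hc i)
      _ = 8 * Aᶜ.card + 2048 * (n * (1472 * Aᶜ.card * D / n)) := by
          rw [Finset.sum_add_distrib, ← Finset.mul_sum]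
          simp only [Finset.sum_ite_mem, Finset.univ_inter, Finset.sum_const, Finset.card_univ,
            Fintype.card_fin, nsmul_eq_mul, mul_one]
          ring
      -- The diagonal contribution is absorbed by D ≥ 1, which holds because δ ≥ 1.
      _ ≤ 8 * Aᶜ.card * D + 2048 * (1472 * Aᶜ.card * D) := by
          refine add_le_add (le_mul_of_one_le_right zero_le hD1) ?_
          exact mul_le_mul_right ENNReal.mul_div_le _
      _ = 3014664 * Aᶜ.card * D := by ring
  calc _ ≤ ∑ i, (256 * K) ^ (1 / 2 : ℝ) * (∫⁻ q, N i q ^ 4 ∂ν) ^ (1 / 2 : ℝ) := by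
        refine Finset.sum_le_sum fun i _ => ?_
        calc _ ≤ ∫⁻ q, (R i q * N i q) ^ 2 ∂ν := by
              refine lintegral_mono fun q => ?_
              gcongr
              exact enorm_prodSum_sub_le hG A i q
          _ ≤ _ := lintegral_mul_sq_le ν (hRm i) (hNm i)
          _ ≤ _ := by
              gcongr
              exact hR4 i
    _ ≤ (256 * K) ^ (1 / 2 : ℝ) * (n * ∑ i, ∫⁻ q, N i q ^ 4 ∂ν) ^ (1 / 2 : ℝ) := by
        rw [← Finset.mul_sum]
        gcongr
        exact sum_rpow_half_le _
    _ ≤ _ := by gcongr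

end Moments

end NormalApprox

namespace NormalApprox

section

variable {𝒳 : Type*} [MeasurableSpace 𝒳] {μ : Measure 𝒳} {n : ℕ} {f : (Fin n → 𝒳) → ℝ}

lemma memLp_pairDelta_of_maxDelta (hf : Measurable f)
    (hK : ∫⁻ p, maxDelta f p ^ 8 ∂iidPair μ n < ∞) (j : Fin n) :
    MemLp (pairDelta f j) 8 (iidPair μ n) := by
  refine ⟨(measurable_pairDelta hf j).aestronglyMeasurable, ?_⟩
  rw [eLpNorm_lt_top_iff_lintegral_rpow_enorm_lt_top (by norm_num) (by norm_num)]
  refine lt_of_le_of_lt (lintegral_mono fun p => ?_) hK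
  rw [show (8 : ℝ≥0∞).toReal = (8 : ℕ) by norm_num, ENNReal.rpow_natCast]
  exact pow_le_pow_left' (enorm_pairDelta_le j p) 8

end

/-! ### Fluctuations of the conditional expectations -/

section Variance

variable {𝒳 : Type*} [MeasurableSpace 𝒳] {μ : Measure 𝒳} [IsProbabilityMeasure μ] {n : ℕ}
  {G : GraphicalRule 𝒳 n} {G' : GraphicalRule 𝒳 (n + 4)} {f : (Fin n → 𝒳) → ℝ}

lemma memLp_pairDelta_mul (hf : Measurable f)
    (hK : ∫⁻ p, maxDelta f p ^ 8 ∂iidPair μ n < ∞) (A : Finset (Fin n)) (j : Fin n) :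
    MemLp (fun p => pairDelta f j p * pairDelta f j (swapOn A p)) 2 (iidPair μ n) := by
  have h4 : MemLp (pairDelta f j) 4 (iidPair μ n) :=
    (memLp_pairDelta_of_maxDelta hf hK j).mono_exponent (by norm_num)
  have : ENNReal.HolderTriple 4 4 2 := ⟨by
    rw [← two_mul, show (4 : ℝ≥0∞) = 2 * 2 by norm_num,
      ENNReal.mul_inv (Or.inl two_ne_zero) (Or.inl ENNReal.ofNat_ne_top), ← mul_assoc,
      ENNReal.mul_inv_cancel two_ne_zero ENNReal.ofNat_ne_top, one_mul]⟩
  exact (memLp_pairDelta_swapOn h4 A).mul' h4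

lemma memLp_prodSum (hf : Measurable f)
    (hK : ∫⁻ p, maxDelta f p ^ 8 ∂iidPair μ n < ∞) (A : Finset (Fin n)) :
    MemLp (prodSum f A) 2 (iidPair μ n) :=
  memLp_finsetSum _ fun j _ => memLp_pairDelta_mul hf hK A j

variable (μ) in
/-- The conditional expectation of `prodSum` given the first vector. -/
noncomputable def condProdSum (f : (Fin n → 𝒳) → ℝ) (A : Finset (Fin n)) (x : Fin n → 𝒳) : ℝ :=
  ∫ x', prodSum f A (x, x') ∂iid μ (Fin n)

lemma enorm_integral_sq_le {α : Type*} [MeasurableSpace α] {ν : Measure α}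
    [IsProbabilityMeasure ν] {u : α → ℝ} (hu : AEStronglyMeasurable u ν) :
    ‖∫ a, u a ∂ν‖ₑ ^ 2 ≤ ∫⁻ a, ‖u a‖ₑ ^ 2 ∂ν := by
  have h1 : ‖∫ a, u a ∂ν‖ₑ ≤ eLpNorm u 1 ν := by
    rw [eLpNorm_one_eq_lintegral_enorm]
    exact enorm_integral_le_lintegral_enorm u
  have h2 := h1.trans (eLpNorm_le_eLpNorm_of_exponent_le (by norm_num : (1 : ℝ≥0∞) ≤ 2) hu)
  have h3 : eLpNorm u 2 ν ^ 2 = ∫⁻ a, ‖u a‖ₑ ^ 2 ∂ν := by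
    have := eLpNorm_nnreal_pow_eq_lintegral (f := u) (μ := ν) (p := 2) (by norm_num)
    simpa using this
  rw [← h3]
  exact pow_le_pow_left' h2 2

lemma stronglyMeasurable_condProdSum (hf : Measurable f) (A : Finset (Fin n)) :
    StronglyMeasurable (condProdSum μ f A) :=
  (measurable_prodSum hf A).stronglyMeasurable.integral_prod_right'

lemma memLp_condProdSum (hf : Measurable f)
    (hK : ∫⁻ p, maxDelta f p ^ 8 ∂iidPair μ n < ∞) (A : Finset (Fin n)) :
    MemLp (condProdSum μ f A) 2 (iid μ (Fin n)) := by
  refine ⟨(stronglyMeasurable_condProdSum hf A).aestronglyMeasurable, ?_⟩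
  have hT := (memLp_prodSum hf hK A).eLpNorm_lt_top
  rw [eLpNorm_lt_top_iff_lintegral_rpow_enorm_lt_top (by norm_num) (by norm_num)] at hT ⊢
  simp only [ENNReal.toReal_ofNat, ENNReal.rpow_ofNat] at hT ⊢
  refine lt_of_le_of_lt ?_ hT
  rw [lintegral_prod _ ((measurable_prodSum hf A).enorm.pow_const 2).aemeasurable]
  refine lintegral_mono fun x => enorm_integral_sq_le ?_
  exact ((measurable_prodSum hf A).comp measurable_prodMk_left).aestronglyMeasurable

lemma integral_condProdSum (hf : Measurable f)
    (hK : ∫⁻ p, maxDelta f p ^ 8 ∂iidPair μ n < ∞) (A : Finset (Fin n)) :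
    ∫ x, condProdSum μ f A x ∂iid μ (Fin n) = ∫ p, prodSum f A p ∂iidPair μ n :=
  (integral_prod _ ((memLp_prodSum hf hK A).integrable one_le_two)).symm

/-- Jensen's inequality: the same second vector x' is used before and after resampling, so the
difference of the conditional expectations is an average over x' of differences. -/
lemma lintegral_pairDelta_condProdSum_le (hf : Measurable f)
    (hK : ∫⁻ p, maxDelta f p ^ 8 ∂iidPair μ n < ∞) (A : Finset (Fin n)) (i : Fin n) :
    ∫⁻ p, ‖pairDelta (condProdSum μ f A) i p‖ₑ ^ 2 ∂iidPair μ n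
      ≤ ∫⁻ q, ‖prodSum f A (q.1.1, q.2) - prodSum f A (replace q.1.1 q.1.2 i, q.2)‖ₑ ^ 2
        ∂(iidPair μ n).prod (iid μ (Fin n)) := by
  have hm := measurable_prodSum hf A
  have hm1 : Measurable fun q : ((Fin n → 𝒳) × (Fin n → 𝒳)) × (Fin n → 𝒳) =>
      prodSum f A (q.1.1, q.2) - prodSum f A (replace q.1.1 q.1.2 i, q.2) :=
    (hm.comp (by fun_prop)).sub
      (hm.comp (((measurable_replace i).comp measurable_fst).prodMk measurable_snd))
  have hint : ∀ᵐ x ∂iid μ (Fin n), Integrable (fun x' => prodSum f A (x, x')) (iid μ (Fin n)) :=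
    ((memLp_prodSum hf hK A).integrable one_le_two).prod_right_ae
  have h1 : ∀ᵐ p ∂iidPair μ n, Integrable (fun x' => prodSum f A (p.1, x')) (iid μ (Fin n)) :=
    (measurePreserving_fst (μ := iid μ (Fin n)) (ν := iid μ (Fin n))).quasiMeasurePreserving.ae hint
  have h2 : ∀ᵐ p ∂iidPair μ n,
      Integrable (fun x' => prodSum f A (replace p.1 p.2 i, x')) (iid μ (Fin n)) :=
    (measurePreserving_replace μ i).quasiMeasurePreserving.ae hint
  rw [lintegral_prod _ (hm1.enorm.pow_const 2).aemeasurable]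
  refine lintegral_mono_ae ?_
  filter_upwards [h1, h2] with p hp1 hp2
  rw [pairDelta_eq, condProdSum, condProdSum, ← integral_sub hp1 hp2]
  exact enorm_integral_sq_le (hm1.comp measurable_prodMk_left).aestronglyMeasurable

lemma integral_pairDelta_sq_eq_toReal {g : (Fin n → 𝒳) → ℝ} (hg : MemLp g 2 (iid μ (Fin n)))
    (i : Fin n) : ∫ p, pairDelta g i p ^ 2 ∂iidPair μ n
      = (∫⁻ p, ‖pairDelta g i p‖ₑ ^ 2 ∂iidPair μ n).toReal := by
  rw [integral_eq_lintegral_of_nonneg_ae (ae_of_all _ fun p => sq_nonneg _)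
    (memLp_pairDelta hg i).integrable_sq.aestronglyMeasurable]
  congr 1
  refine lintegral_congr fun p => ?_
  rw [← sq_abs, ENNReal.ofReal_pow (abs_nonneg _), ← Real.enorm_eq_ofReal_abs]

/-- The L¹ norm is at most the L² norm, which Efron–Stein controls; taking the root of the variance
bound turns square roots into fourth roots. -/
lemma integral_abs_condProdSum_sub_le (hsymm : G'.IsSymmetric) (hext : G'.IsExtension G)
    (hG' : ∀ i j, MeasurableSet {y | (G' y).Adj i j}) (hG : G.IsInteractionRule f)
    (hf : Measurable f) (hK : ∫⁻ p, maxDelta f p ^ 8 ∂iidPair μ n < ∞) (A : Finset (Fin n)) :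
    ∫ x, |condProdSum μ f A x - ∫ p, prodSum f A p ∂iidPair μ n| ∂iid μ (Fin n)
      ≤ 118 * (√√(n : ℝ) * √√(n - A.card : ℝ)
        * √√((∫⁻ p, maxDelta f p ^ 8 ∂iidPair μ n).toReal
          * (∫⁻ y, (onePlusDegree (G' y) 0 : ℝ≥0∞) ^ 4 ∂iid μ (Fin (n + 4))).toReal)) := by
  set g := condProdSum μ f A
  set K := ∫⁻ p, maxDelta f p ^ 8 ∂iidPair μ n
  set D := ∫⁻ y, (onePlusDegree (G' y) 0 : ℝ≥0∞) ^ 4 ∂iid μ (Fin (n + 4)) with hD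
  have hDt : D < ∞ := lintegral_onePlusDegree_lt_top μ G' 0
  have hg : MemLp g 2 (iid μ (Fin n)) := memLp_condProdSum hf hK A
  have hbn : (Aᶜ.card : ℝ) = n - A.card := by
    rw [Finset.card_compl, Fintype.card_fin, Nat.cast_sub (card_finset_fin_le A)]
  have hS := sum_lintegral_prodSum_sub_le (μ := μ) hsymm hext hG' hG hf A
  rw [← hD] at hS
  have hfin : (256 * K) ^ (1 / 2 : ℝ) * (n * (3014664 * Aᶜ.card * D)) ^ (1 / 2 : ℝ) ≠ ∞ := by
    refine ENNReal.mul_ne_top (ENNReal.rpow_ne_top_of_nonneg (by norm_num) ?_)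
      (ENNReal.rpow_ne_top_of_nonneg (by norm_num) ?_)
    · exact ENNReal.mul_ne_top (by simp) hK.ne
    · exact ENNReal.mul_ne_top (by simp) (ENNReal.mul_ne_top
        (ENNReal.mul_ne_top (by simp) (by simp)) hDt.ne)
  have hS2 : ∑ i, ∫ p, pairDelta g i p ^ 2 ∂iidPair μ n
      ≤ √(256 * K.toReal) * √(n * (3014664 * Aᶜ.card * D.toReal)) := by
    simp_rw [integral_pairDelta_sq_eq_toReal hg]
    have h1 : ∑ i, ∫⁻ p, ‖pairDelta g i p‖ₑ ^ 2 ∂iidPair μ n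
        ≤ (256 * K) ^ (1 / 2 : ℝ) * (n * (3014664 * Aᶜ.card * D)) ^ (1 / 2 : ℝ) :=
      (Finset.sum_le_sum fun i _ => lintegral_pairDelta_condProdSum_le hf hK A i).trans hS
    have h2 := ENNReal.toReal_mono hfin h1
    rw [ENNReal.toReal_sum fun i _ => ne_top_of_le_ne_top hfin
      ((Finset.single_le_sum (f := fun i => ∫⁻ p, ‖pairDelta g i p‖ₑ ^ 2 ∂iidPair μ n)
        (fun _ _ => zero_le) (Finset.mem_univ i)).trans h1), ENNReal.toReal_mul,
      ← ENNReal.toReal_rpow, ← ENNReal.toReal_rpow] at h2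
    simpa [Real.sqrt_eq_rpow] using h2
  have hES := integral_sub_integral_sq_le hg
  rw [integral_condProdSum hf hK A] at hES
  set m := ∫ p, prodSum f A p ∂iidPair μ n
  have hgm : MemLp (fun x => g x - m) 2 (iid μ (Fin n)) := hg.sub (memLp_const m)
  have hL1 : ∫ x, |g x - m| ∂iid μ (Fin n) ≤ √(∫ x, (g x - m) ^ 2 ∂iid μ (Fin n)) := by
    apply Real.le_sqrt_of_sq_le
    have habs : MemLp (fun x => |g x - m|) 2 (iid μ (Fin n)) := hgm.abs
    have h := variance_nonneg (fun x => |g x - m|) (iid μ (Fin n))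
    rw [variance_eq_sub habs] at h
    simpa [sq_abs] using h
  refine hL1.trans ?_
  have hb : ∫ x, (g x - m) ^ 2 ∂iid μ (Fin n)
      ≤ 118 ^ 2 * (√(n : ℝ) * √(n - A.card : ℝ) * √(K.toReal * D.toReal)) := by
    refine hES.trans ?_
    have e1 : √(256 * K.toReal) = 16 * √K.toReal := by
      rw [Real.sqrt_mul (by norm_num), show (256 : ℝ) = 16 ^ 2 by norm_num,
        Real.sqrt_sq (by norm_num)]
    have e2 : √(n * (3014664 * Aᶜ.card * D.toReal))
        = √3014664 * (√n * √(n - A.card : ℝ) * √D.toReal) := by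
      rw [hbn, Real.sqrt_mul (Nat.cast_nonneg _), Real.sqrt_mul (by
        rw [← hbn]
        positivity), Real.sqrt_mul (by norm_num)]
      ring
    have e3 : √(3014664 : ℝ) ≤ 1737 := Real.sqrt_le_iff.2 ⟨by norm_num, by norm_num⟩
    rw [e1, e2] at hS2
    rw [Real.sqrt_mul ENNReal.toReal_nonneg]
    set u := √(n : ℝ) * √(n - A.card : ℝ) * √D.toReal with hu
    have hu0 : 0 ≤ u := by positivity
    have hk0 : 0 ≤ √K.toReal := Real.sqrt_nonneg _
    calc 1 / 2 * ∑ i, ∫ p, pairDelta g i p ^ 2 ∂iidPair μ n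
        ≤ 1 / 2 * (16 * √K.toReal * (1737 * u)) := by
          refine mul_le_mul_of_nonneg_left (hS2.trans ?_) (by norm_num)
          gcongr
      _ = 13896 * (√K.toReal * u) := by ring
      -- 13896 = ½ · 16 · 1737 is rounded up to the square 13924 = 118².
      _ ≤ 118 ^ 2 * (√K.toReal * u) := by
          gcongr
          norm_num
      _ = _ := by
          rw [hu]
          ring
  refine (Real.sqrt_le_sqrt hb).trans (le_of_eq ?_)
  rw [Real.sqrt_mul (by norm_num), Real.sqrt_sq (by norm_num), Real.sqrt_mul (by positivity),
    Real.sqrt_mul (Real.sqrt_nonneg _)]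

end Variance

/-! ### Stein's method for normalized functions -/

section SteinBound

variable {𝒳 : Type*} [MeasurableSpace 𝒳] {μ : Measure 𝒳} [IsProbabilityMeasure μ] {n : ℕ}
  {G : GraphicalRule 𝒳 n} {G' : GraphicalRule 𝒳 (n + 4)} {f : (Fin n → 𝒳) → ℝ}

lemma integrable_abs_pairDelta_pow_three (hf : Measurable f)
    (hK : ∫⁻ p, maxDelta f p ^ 8 ∂iidPair μ n < ∞) (j : Fin n) :
    Integrable (fun p => |pairDelta f j p| ^ 3) (iidPair μ n) := by
  have h3 : MemLp (pairDelta f j) (3 : ℕ) (iidPair μ n) :=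
    (memLp_pairDelta_of_maxDelta hf hK j).mono_exponent (by norm_num)
  exact h3.integrable_norm_pow (by norm_num)

/-- Linearizing φ leaves an error |Δ_j f(X)|² |Δ_j f(X^A)|. Young's inequality bounds it by third
powers of two variables with the same law. -/
lemma abs_integral_taylor_remainder_le {φ φ' : ℝ → ℝ}
    (hT : ∀ a b, |φ b - φ a - φ' a * (b - a)| ≤ (b - a) ^ 2) (hf : Measurable f)
    (hK : ∫⁻ p, maxDelta f p ^ 8 ∂iidPair μ n < ∞) (A : Finset (Fin n)) (j : Fin n) :
    |∫ p, (φ' (f p.1) * pairDelta f j p - pairDelta (φ ∘ f) j p) * pairDelta f j (swapOn A p)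
        ∂iidPair μ n| ≤ ∫ p, |pairDelta f j p| ^ 3 ∂iidPair μ n := by
  have hi := integrable_abs_pairDelta_pow_three hf hK j
  have hs := measurePreserving_swapOn μ A
  have hi2 : Integrable (fun p => |pairDelta f j (swapOn A p)| ^ 3) (iidPair μ n) :=
    hs.integrable_comp_of_integrable hi
  have e : ∫ p, |pairDelta f j (swapOn A p)| ^ 3 ∂iidPair μ n
      = ∫ p, |pairDelta f j p| ^ 3 ∂iidPair μ n := by
    have hm : AEStronglyMeasurable (fun p => |pairDelta f j p| ^ 3)
      ((iidPair μ n).map (swapOn A)) := by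
      rw [hs.map_eq]
      exact hi.aestronglyMeasurable
    have h := integral_map hs.measurable.aemeasurable hm
    rw [hs.map_eq] at h
    exact h.symm
  rw [← Real.norm_eq_abs]
  calc _ ≤ ∫ p, (2 / 3 * |pairDelta f j p| ^ 3 + 1 / 3 * |pairDelta f j (swapOn A p)| ^ 3)
          ∂iidPair μ n := by
        refine norm_integral_le_of_norm_le ((hi.const_mul _).add (hi2.const_mul _))
          (ae_of_all _ fun p => ?_)
        have h1 := hT (f p.1) (f (replace p.1 p.2 j))
        have h2 : φ' (f p.1) * pairDelta f j p - pairDelta (φ ∘ f) j p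
            = φ (f (replace p.1 p.2 j)) - φ (f p.1)
              - φ' (f p.1) * (f (replace p.1 p.2 j) - f p.1) := by
          simp only [pairDelta_eq, Function.comp]
          ring
        have h3 : (f (replace p.1 p.2 j) - f p.1) ^ 2 = |pairDelta f j p| ^ 2 := by
          rw [sq_abs, pairDelta_eq]
          ring
        rw [h3] at h1
        rw [norm_mul, Real.norm_eq_abs, Real.norm_eq_abs, h2]
        have ha := abs_nonneg (pairDelta f j p)
        have hb := abs_nonneg (pairDelta f j (swapOn A p))
        set a := |pairDelta f j p|
        set b := |pairDelta f j (swapOn A p)|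
        calc _ ≤ a ^ 2 * b := by gcongr
          -- (a − b)² (2a + b) = 2a³ − 3a²b + b³.
          _ ≤ _ := by nlinarith [mul_nonneg (sq_nonneg (a - b)) (by positivity : 0 ≤ 2 * a + b)]
    _ = _ := by
        rw [integral_add (hi.const_mul _) (hi2.const_mul _), integral_const_mul,
          integral_const_mul, e]
        ring

lemma memLp_comp_of_abs_deriv_le {Ω : Type*} [MeasurableSpace Ω] {ν : Measure Ω}
    [IsFiniteMeasure ν] {φ φ' : ℝ → ℝ} {C : ℝ} (hd : ∀ w, HasDerivAt φ (φ' w) w)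
    (hb : ∀ w, |φ' w| ≤ C) {u : Ω → ℝ} (hu : Measurable u) {q : ℝ≥0∞} (hq : MemLp u q ν) :
    MemLp (φ ∘ u) q ν := by
  have hcφ : Continuous φ := continuous_iff_continuousAt.2 fun w => (hd w).continuousAt
  have h1 : MemLp (fun x => |φ 0| + C * |u x|) q ν :=
    (memLp_const |φ 0|).add (hq.norm.const_mul C)
  refine h1.mono (hcφ.measurable.comp hu).aestronglyMeasurable (ae_of_all _ fun x => ?_)
  have h2 : |φ (u x) - φ 0| ≤ C * |u x - 0| :=
    Convex.norm_image_sub_le_of_norm_hasDerivWithin_le (f := φ) (f' := φ') (s := Set.univ)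
      (fun w _ => (hd w).hasDerivWithinAt) (fun w _ => hb w) convex_univ (Set.mem_univ 0)
      (Set.mem_univ (u x))
  rw [sub_zero] at h2
  have h3 : |φ (u x)| ≤ |φ 0| + |φ (u x) - φ 0| := by
    simpa using abs_add_le (φ 0) (φ (u x) - φ 0)
  rw [Real.norm_eq_abs, Real.norm_eq_abs, Function.comp_apply]
  exact (h3.trans (by linarith)).trans (le_abs_self _)

set_option maxHeartbeats 1000000 in
/-- Stein's method for a normalized function of independent random variables. -/
theorem abs_integral_sub_gaussian_le (hsymm : G'.IsSymmetric) (hext : G'.IsExtension G)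
    (hG' : ∀ i j, MeasurableSet {y | (G' y).Adj i j}) (hG : G.IsInteractionRule f)
    (hf : Measurable f) (hK : ∫⁻ p, maxDelta f p ^ 8 ∂iidPair μ n < ∞)
    (hf2 : MemLp f 2 (iid μ (Fin n))) (hmean : ∫ x, f x ∂iid μ (Fin n) = 0)
    (hvar : ∫ x, f x * f x ∂iid μ (Fin n) = 1) {h : ℝ → ℝ} (hh : LipschitzWith 1 h) :
    |∫ x, h (f x) ∂iid μ (Fin n) - ∫ s, h s ∂gaussianReal 0 1|
      ≤ 1652 * (√(n : ℝ) * √√((∫⁻ p, maxDelta f p ^ 8 ∂iidPair μ n).toReal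
          * (∫⁻ y, (onePlusDegree (G' y) 0 : ℝ≥0∞) ^ 4 ∂iid μ (Fin (n + 4))).toReal))
        + 1 / 2 * ∑ j, ∫ p, |pairDelta f j p| ^ 3 ∂iidPair μ n := by
  obtain ⟨φ, φ', hd, hc', heq, hb, hT⟩ := exists_stein_solution hh
  set Z := √√((∫⁻ p, maxDelta f p ^ 8 ∂iidPair μ n).toReal
          * (∫⁻ y, (onePlusDegree (G' y) 0 : ℝ≥0∞) ^ 4 ∂iid μ (Fin (n + 4))).toReal) with hZ
  have hcφ : Continuous φ := continuous_iff_continuousAt.2 fun w => (hd w).continuousAt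
  have hφf : MemLp (φ ∘ f) 2 (iid μ (Fin n)) := memLp_comp_of_abs_deriv_le hd hb hf hf2
  have hφ'm : Measurable fun x => φ' (f x) := hc'.measurable.comp hf
  have hφ'i : Integrable (fun x => φ' (f x)) (iid μ (Fin n)) :=
    Integrable.of_bound hφ'm.aestronglyMeasurable 7 (ae_of_all _ fun x => hb _)
  have hφfi : Integrable (fun x => φ (f x) * f x) (iid μ (Fin n)) := hφf.integrable_mul hf2
  set c := ∫ x, φ' (f x) ∂iid μ (Fin n) with hc
  have hhi : Integrable (fun x => h (f x)) (iid μ (Fin n)) := by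
    have e : (fun x => h (f x)) = fun x => (φ' (f x) - φ (f x) * f x)
        + ∫ s, h s ∂gaussianReal 0 1 := by
      funext x
      linarith [heq (f x)]
    rw [e]
    exact (hφ'i.sub hφfi).add (integrable_const _)
  have hL : ∫ x, h (f x) ∂iid μ (Fin n) - ∫ s, h s ∂gaussianReal 0 1
      = c - ∫ x, φ (f x) * f x ∂iid μ (Fin n) := by
    rw [hc, ← integral_sub hφ'i hφfi]
    have e : ∀ x, φ' (f x) - φ (f x) * f x = h (f x) - ∫ s, h s ∂gaussianReal 0 1 := fun x => by
      rw [← heq (f x)]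
      ring
    simp_rw [e]
    rw [integral_sub hhi (integrable_const _)]
    simp
  have hcov := integral_mul_sub_integral_mul_integral hf2 hφf
  have hcov1 := integral_mul_sub_integral_mul_integral hf2 hf2
  rw [hmean, mul_zero, sub_zero] at hcov hcov1
  rw [hvar] at hcov1
  simp only [Function.comp_apply] at hcov
  have hDD : ∀ (A : Finset (Fin n)) (j : Fin n), Integrable
      (fun p => pairDelta f j p * pairDelta f j (swapOn A p)) (iidPair μ n) := fun A j =>
    (memLp_pairDelta_mul hf hK A j).integrable one_le_two
  have hPD : ∀ (A : Finset (Fin n)) (j : Fin n), Integrable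
      (fun p => pairDelta (φ ∘ f) j p * pairDelta f j (swapOn A p)) (iidPair μ n) := fun A j =>
    (memLp_pairDelta hφf j).integrable_mul (memLp_pairDelta_swapOn (memLp_pairDelta hf2 j) A)
  have hbdd : ∀ {u : (Fin n → 𝒳) × (Fin n → 𝒳) → ℝ}, Integrable u (iidPair μ n) →
      Integrable (fun p => φ' (f p.1) * u p) (iidPair μ n) := fun hu =>
    hu.bdd_mul (hφ'm.comp measurable_fst).aestronglyMeasurable (ae_of_all _ fun p => hb _)
  set E : Finset (Fin n) → ℝ := fun A => c * ∫ p, prodSum f A p ∂iidPair μ n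
    - ∑ j ∈ Aᶜ, ∫ p, pairDelta (φ ∘ f) j p * pairDelta f j (swapOn A p) ∂iidPair μ n with hE
  -- The covariance identity for f with itself represents the variance 1, so c can be distributed
  -- over the same weighted sum.
  have hmain : c - ∫ x, φ (f x) * f x ∂iid μ (Fin n) = 1 / 2 * ∑ A, weight A * E A := by
    have e1 : ∀ A : Finset (Fin n), ∫ p, prodSum f A p ∂iidPair μ n
        = ∑ j ∈ Aᶜ, ∫ p, pairDelta f j p * pairDelta f j (swapOn A p) ∂iidPair μ n := fun A =>
      integral_finsetSum _ fun j _ => hDD A j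
    simp_rw [hE, e1, mul_sub, Finset.sum_sub_distrib, mul_sub]
    rw [hcov]
    congr 1
    have e2 : ∀ A : Finset (Fin n), weight A * (c * ∑ j ∈ Aᶜ,
        ∫ p, pairDelta f j p * pairDelta f j (swapOn A p) ∂iidPair μ n)
        = c * (weight A * ∑ j ∈ Aᶜ,
          ∫ p, pairDelta f j p * pairDelta f j (swapOn A p) ∂iidPair μ n) := fun A => by ring
    simp_rw [e2]
    rw [← Finset.mul_sum, mul_left_comm, ← hcov1, mul_one]
  have hEA : ∀ A, |E A| ≤ 826 * (√√(n : ℝ) * √√(n - A.card : ℝ) * Z)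
      + ∑ j ∈ Aᶜ, ∫ p, |pairDelta f j p| ^ 3 ∂iidPair μ n := by
    intro A
    have hgi := (memLp_condProdSum hf hK A).integrable one_le_two
    set m := ∫ p, prodSum f A p ∂iidPair μ n with hm
    have hTi : Integrable (prodSum f A) (iidPair μ n) :=
      (memLp_prodSum hf hK A).integrable one_le_two
    have e1 : ∫ p, φ' (f p.1) * prodSum f A p ∂iidPair μ n
        -- φ'(W) depends on X only, so X' can be integrated out and only the conditional expectation
        -- has to concentrate.
        = ∫ x, φ' (f x) * condProdSum μ f A x ∂iid μ (Fin n) := by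
      rw [integral_prod _ (hbdd hTi)]
      simp_rw [integral_const_mul]
      rfl
    have e2 : ∫ p, φ' (f p.1) * prodSum f A p ∂iidPair μ n
        = ∑ j ∈ Aᶜ, ∫ p, φ' (f p.1) * (pairDelta f j p * pairDelta f j (swapOn A p))
          ∂iidPair μ n := by
      rw [← integral_finsetSum _ fun j _ => hbdd (hDD A j)]
      simp_rw [prodSum, Finset.mul_sum]
    have hgi' : Integrable (fun x => φ' (f x) * condProdSum μ f A x) (iid μ (Fin n)) :=
      hgi.bdd_mul hφ'm.aestronglyMeasurable (ae_of_all _ fun x => hb _)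
    have e3 : E A = ∫ x, φ' (f x) * (m - condProdSum μ f A x) ∂iid μ (Fin n)
        + ∑ j ∈ Aᶜ, ∫ p, (φ' (f p.1) * pairDelta f j p - pairDelta (φ ∘ f) j p)
          * pairDelta f j (swapOn A p) ∂iidPair μ n := by
      have e4 : ∫ x, φ' (f x) * (m - condProdSum μ f A x) ∂iid μ (Fin n)
          = c * m - ∫ x, φ' (f x) * condProdSum μ f A x ∂iid μ (Fin n) := by
        simp_rw [mul_sub]
        rw [integral_sub (hφ'i.mul_const m) hgi', integral_mul_const]
      have e5 : ∀ j ∈ Aᶜ, ∫ p, (φ' (f p.1) * pairDelta f j p - pairDelta (φ ∘ f) j p)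
          * pairDelta f j (swapOn A p) ∂iidPair μ n
          = ∫ p, φ' (f p.1) * (pairDelta f j p * pairDelta f j (swapOn A p)) ∂iidPair μ n
            - ∫ p, pairDelta (φ ∘ f) j p * pairDelta f j (swapOn A p) ∂iidPair μ n := by
        intro j _
        rw [← integral_sub (hbdd (hDD A j)) (hPD A j)]
        refine integral_congr_ae (ae_of_all _ fun p => ?_)
        ring
      rw [e4, Finset.sum_congr rfl e5, Finset.sum_sub_distrib, ← e2, e1, hE]
      ring
    rw [e3]
    refine (abs_add_le _ _).trans (add_le_add ?_ ?_)
    · have h1 := integral_abs_condProdSum_sub_le (μ := μ) hsymm hext hG' hG hf hK A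
      rw [← hZ, ← hm] at h1
      calc |∫ x, φ' (f x) * (m - condProdSum μ f A x) ∂iid μ (Fin n)|
          ≤ ∫ x, 7 * |condProdSum μ f A x - m| ∂iid μ (Fin n) := by
            rw [← Real.norm_eq_abs]
            refine norm_integral_le_of_norm_le
              ((hgi.sub (integrable_const m)).abs.const_mul 7) (ae_of_all _ fun x => ?_)
            rw [norm_mul, Real.norm_eq_abs, Real.norm_eq_abs, abs_sub_comm]
            exact mul_le_mul_of_nonneg_right (hb _) (abs_nonneg _)
        _ = 7 * ∫ x, |condProdSum μ f A x - m| ∂iid μ (Fin n) := integral_const_mul _ _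
        _ ≤ 7 * (118 * (√√(n : ℝ) * √√(n - A.card : ℝ) * Z)) := by gcongr
        _ = _ := by ring
    · exact (Finset.abs_sum_le_sum_abs _ _).trans
        (Finset.sum_le_sum fun j _ => abs_integral_taylor_remainder_le hT hf hK A j)
  rw [hL, hmain, abs_mul, abs_of_pos (by norm_num : (0 : ℝ) < 1 / 2)]
  have hZ0 : 0 ≤ Z := Real.sqrt_nonneg _
  calc 1 / 2 * |∑ A, weight A * E A|
      ≤ 1 / 2 * ∑ A, weight A * (826 * (√√(n : ℝ) * √√(n - A.card : ℝ) * Z)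
          + ∑ j ∈ Aᶜ, ∫ p, |pairDelta f j p| ^ 3 ∂iidPair μ n) := by
        refine mul_le_mul_of_nonneg_left ((Finset.abs_sum_le_sum_abs _ _).trans
          (Finset.sum_le_sum fun A _ => ?_)) (by norm_num)
        rw [abs_mul, abs_of_nonneg (weight_nonneg A)]
        exact mul_le_mul_of_nonneg_left (hEA A) (weight_nonneg A)
    _ = 413 * (√√(n : ℝ) * Z) * ∑ A : Finset (Fin n), weight A * √√(n - A.card : ℝ)
        + 1 / 2 * ∑ j, ∫ p, |pairDelta f j p| ^ 3 ∂iidPair μ n := by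
        have e1 : ∀ A : Finset (Fin n), weight A * (826 * (√√(n : ℝ) * √√(n - A.card : ℝ) * Z))
            = 826 * (√√(n : ℝ) * Z) * (weight A * √√(n - A.card : ℝ)) := fun A => by ring
        simp_rw [mul_add, Finset.sum_add_distrib, e1]
        rw [sum_weight_mul_sum_compl, ← Finset.mul_sum]
        ring
    _ ≤ 413 * (√√(n : ℝ) * Z) * (4 * √√(n : ℝ))
        + 1 / 2 * ∑ j, ∫ p, |pairDelta f j p| ^ 3 ∂iidPair μ n := by
        gcongr
        exact sum_weight_mul_sqrt_sqrt_le n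
    -- Both factors n^{1/4}, one from the variance bound and one from the sum of weights, combine to
    -- √n; 1652 = 4 · ½ · 7 · 118.
    _ = _ := by
        have : √√(n : ℝ) * √√(n : ℝ) = √(n : ℝ) := Real.mul_self_sqrt (Real.sqrt_nonneg _)
        linear_combination 1652 * Z * this

end SteinBound

end NormalApprox

namespace NormalApprox

/-! ### Reduction to mean zero and variance one -/

section Scaling

variable {𝒳 : Type*} {n : ℕ}

lemma GraphicalRule.IsInteractionRule.affine {G : GraphicalRule 𝒳 n} {f : (Fin n → 𝒳) → ℝ}
    (hG : G.IsInteractionRule f) (m σ : ℝ) :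
    G.IsInteractionRule fun x => (f x - m) / σ := by
  intro x x' i j hij h1 h2 h3 h4
  have h := hG x x' i j hij h1 h2 h3 h4
  simp only [Noninteracting, ← sub_div, sub_sub_sub_cancel_right] at h ⊢
  rw [h]

lemma enorm_delta_affine (f : (Fin n → 𝒳) → ℝ) (m : ℝ) {σ : ℝ} (hσ : 0 < σ)
    (x x' : Fin n → 𝒳) (j : Fin n) :
    ‖delta (fun x => (f x - m) / σ) x x' j‖ₑ = ENNReal.ofReal σ⁻¹ * ‖delta f x x' j‖ₑ := by
  have h : delta (fun x => (f x - m) / σ) x x' j = σ⁻¹ * delta f x x' j := by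
    simp only [delta]
    ring
  rw [h, enorm_mul, Real.enorm_eq_ofReal (inv_pos.2 hσ).le]

lemma maxDelta_affine (f : (Fin n → 𝒳) → ℝ) (m : ℝ) {σ : ℝ} (hσ : 0 < σ)
    (p : (Fin n → 𝒳) × (Fin n → 𝒳)) :
    maxDelta (fun x => (f x - m) / σ) p = ENNReal.ofReal σ⁻¹ * maxDelta f p := by
  simp only [maxDelta, enorm_delta_affine f m hσ, ENNReal.mul_iSup]

end Scaling

lemma ofReal_sqrt_sqrt {x : ℝ} (hx : 0 ≤ x) :
    ENNReal.ofReal √√x = ENNReal.ofReal x ^ (1 / 4 : ℝ) := by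
  rw [Real.sqrt_eq_rpow, Real.sqrt_eq_rpow, ← Real.rpow_mul hx,
    ENNReal.ofReal_rpow_of_nonneg hx (by norm_num)]
  norm_num

/-! ### The bound on the product space -/

section Product

variable {𝒳 : Type*} [MeasurableSpace 𝒳] {μ : Measure 𝒳} [IsProbabilityMeasure μ] {n : ℕ}
  {G : GraphicalRule 𝒳 n} {G' : GraphicalRule 𝒳 (n + 4)} {f : (Fin n → 𝒳) → ℝ}

/-- The normal approximation bound on the product space. -/
theorem ofReal_abs_integral_sub_gaussian_le (hsymm : G'.IsSymmetric) (hext : G'.IsExtension G)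
    (hG' : ∀ i j, MeasurableSet {y | (G' y).Adj i j}) (hG : G.IsInteractionRule f)
    (hf : Measurable f) (hn : 1 ≤ n) (hf2 : MemLp f 2 (iid μ (Fin n))) {σ : ℝ} (hσ : 0 < σ)
    (hvar : σ ^ 2 = variance f (iid μ (Fin n))) {h : ℝ → ℝ} (hh : LipschitzWith 1 h) :
    ENNReal.ofReal |∫ x, h ((f x - ∫ y, f y ∂iid μ (Fin n)) / σ) ∂iid μ (Fin n)
        - ∫ s, h s ∂gaussianReal 0 1|
      ≤ ENNReal.ofReal (1652 * √(n : ℝ) / σ ^ 2)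
          * (∫⁻ p, maxDelta f p ^ 8 ∂iidPair μ n) ^ (1 / 4 : ℝ)
          * (∫⁻ y, (onePlusDegree (G' y) 0 : ℝ≥0∞) ^ 4 ∂iid μ (Fin (n + 4))) ^ (1 / 4 : ℝ)
        + ENNReal.ofReal (1 / (2 * σ ^ 3))
          * ∑ j, ∫⁻ p, ‖delta f p.1 p.2 j‖ₑ ^ 3 ∂iidPair μ n := by
  set K := ∫⁻ p, maxDelta f p ^ 8 ∂iidPair μ n with hKdef
  set D := ∫⁻ y, (onePlusDegree (G' y) 0 : ℝ≥0∞) ^ 4 ∂iid μ (Fin (n + 4)) with hDdef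
  have hD1 : 1 ≤ D := one_le_lintegral_onePlusDegree μ G' 0
  have hDt : D < ∞ := lintegral_onePlusDegree_lt_top μ G' 0
  have hn0 : (0 : ℝ) < n := by exact_mod_cast hn
  -- If E M⁸ is infinite the right side is infinite, since its other factors are nonzero (n ≥ 1 and
  -- D ≥ 1).
  rcases eq_top_or_lt_top K with hK | hK
  · have hD0 : D ^ (1 / 4 : ℝ) ≠ 0 := by
      have := ENNReal.rpow_pos (p := 1 / 4) (lt_of_lt_of_le one_pos hD1) hDt.ne
      exact this.ne'
    have hc : ENNReal.ofReal (1652 * √(n : ℝ) / σ ^ 2) ≠ 0 := by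
      rw [Ne, ENNReal.ofReal_eq_zero, not_le]
      positivity
    rw [hK, ENNReal.top_rpow_of_pos (by norm_num), ENNReal.mul_top hc, ENNReal.top_mul hD0,
      top_add]
    exact le_top
  set m := ∫ y, f y ∂iid μ (Fin n) with hm
  set F : (Fin n → 𝒳) → ℝ := fun x => (f x - m) / σ with hF
  have hFm : Measurable F := (hf.sub_const m).div_const σ
  have hfi : Integrable f (iid μ (Fin n)) := hf2.integrable one_le_two
  have hF2 : MemLp F 2 (iid μ (Fin n)) := by
    have h1 : MemLp (fun x => f x - m) 2 (iid μ (Fin n)) := hf2.sub (memLp_const m)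
    have h2 := h1.const_mul σ⁻¹
    simpa only [hF, div_eq_inv_mul] using h2
  have hmean : ∫ x, F x ∂iid μ (Fin n) = 0 := by
    rw [hF, integral_div, integral_sub hfi (integrable_const _)]
    simp [hm]
  have hvar' : ∫ x, F x * F x ∂iid μ (Fin n) = 1 := by
    rw [variance_eq_integral hf.aemeasurable] at hvar
    have e : ∀ x, F x * F x = (f x - m) ^ 2 / σ ^ 2 := fun x => by
      simp only [hF]
      ring
    simp_rw [e]
    rw [integral_div, ← hvar, div_self (by positivity)]
  have hKF : ∫⁻ p, maxDelta F p ^ 8 ∂iidPair μ n = ENNReal.ofReal σ⁻¹ ^ 8 * K := by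
    simp_rw [hF, maxDelta_affine f m hσ, mul_pow]
    rw [lintegral_const_mul' _ _ (by simp)]
  have hKFt : ∫⁻ p, maxDelta F p ^ 8 ∂iidPair μ n < ∞ := by
    rw [hKF]
    exact ENNReal.mul_lt_top (by simp) hK
  have key := abs_integral_sub_gaussian_le (μ := μ) hsymm hext hG' (hG.affine m σ) hFm hKFt hF2
    hmean hvar' hh
  refine (ENNReal.ofReal_le_ofReal key).trans ?_
  have hthird : ∀ j, ENNReal.ofReal (∫ p, |pairDelta F j p| ^ 3 ∂iidPair μ n)
      = ENNReal.ofReal σ⁻¹ ^ 3 * ∫⁻ p, ‖delta f p.1 p.2 j‖ₑ ^ 3 ∂iidPair μ n := by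
    intro j
    rw [ofReal_integral_eq_lintegral_ofReal (integrable_abs_pairDelta_pow_three hFm hKFt j)
      (ae_of_all _ fun p => by positivity), ← lintegral_const_mul' _ _ (by simp)]
    refine lintegral_congr fun p => ?_
    rw [ENNReal.ofReal_pow (abs_nonneg _), ← Real.enorm_eq_ofReal_abs, pairDelta, hF,
      enorm_delta_affine f m hσ, mul_pow]
  rw [ENNReal.ofReal_add (by positivity) (by positivity)]
  refine add_le_add (le_of_eq ?_) (le_of_eq ?_)
  · rw [ENNReal.ofReal_mul (by norm_num), ENNReal.ofReal_mul (Real.sqrt_nonneg _),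
      ofReal_sqrt_sqrt (by positivity), ENNReal.ofReal_mul ENNReal.toReal_nonneg,
      ENNReal.ofReal_toReal hKFt.ne, ENNReal.ofReal_toReal hDt.ne, hKF,
      ENNReal.mul_rpow_of_nonneg _ _ (by norm_num), ENNReal.mul_rpow_of_nonneg _ _ (by norm_num),
      ← ENNReal.rpow_natCast, ← ENNReal.rpow_mul]
    -- Normalizing multiplies E M⁸ by σ⁻⁸, whose fourth root is the σ⁻² in the bound.
    have e : ENNReal.ofReal (1652 * √(n : ℝ) / σ ^ 2)
        = ENNReal.ofReal 1652 * ENNReal.ofReal √(n : ℝ) * ENNReal.ofReal σ⁻¹ ^ 2 := by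
      rw [div_eq_mul_inv, ← inv_pow, ENNReal.ofReal_mul (by positivity),
        ENNReal.ofReal_mul (by norm_num), ENNReal.ofReal_pow (inv_pos.2 hσ).le]
    rw [e, show ((8 : ℕ) : ℝ) * (1 / 4) = (2 : ℕ) by norm_num, ENNReal.rpow_natCast]
    ring
  · rw [ENNReal.ofReal_mul (by norm_num),
      ENNReal.ofReal_sum_of_nonneg fun j _ => integral_nonneg fun p => by positivity]
    rw [Finset.sum_congr rfl fun j _ => hthird j]
    rw [← Finset.mul_sum, ← mul_assoc]
    congr 1
    rw [← ENNReal.ofReal_pow (inv_pos.2 hσ).le, ← ENNReal.ofReal_mul (by norm_num)]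
    congr 1
    field_simp

end Product

end NormalApprox

/-! ### Transfer to arbitrary probability spaces -/

theorem theorem2p5 :
    ∃ C : ℝ, 0 < C ∧
      ∀ {𝒳 : Type*} [MeasurableSpace 𝒳] {Ω : Type*} [MeasurableSpace Ω]
        (P : Measure Ω) [IsProbabilityMeasure P]
        (n : ℕ) (_hn : 1 ≤ n)
        (f : (Fin n → 𝒳) → ℝ) (_hf : Measurable f)
        (G : NormalApprox.GraphicalRule 𝒳 n)
        (_hGsymm : G.IsSymmetric) (_hGf : G.IsInteractionRule f)
        (G' : NormalApprox.GraphicalRule 𝒳 (n + 4))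
        (_hG'symm : G'.IsSymmetric) (_hG'ext : G'.IsExtension G)
        (_hG'meas : ∀ i j, MeasurableSet {y : Fin (n + 4) → 𝒳 | (G' y).Adj i j})
        -- an i.i.d. sequence, indexed from `0`
        (ξ : ℕ → Ω → 𝒳) (_hξ : ∀ i, Measurable (ξ i))
        (_hindep : iIndepFun ξ P) (_hident : ∀ i, IdentDistrib (ξ i) (ξ 0) P P)
        -- `X` is its initial segment of length `n`, and `X'` an independent copy of `X`
        (X X' : Ω → Fin n → 𝒳) (_hX : ∀ ω i, X ω i = ξ i ω) (_hX'meas : Measurable X')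
        (_hcopy : IdentDistrib X' X P P) (_hcopyindep : IndepFun X X' P)
        -- `W = f(X)` has finite second moment and positive variance `σ²`
        (_hW : MemLp (fun ω => f (X ω)) 2 P)
        (σ : ℝ) (_hσ : 0 < σ) (_hvar : σ ^ 2 = variance (fun ω => f (X ω)) P),
        NormalApprox.distToNormal P (fun ω => f (X ω)) ≤
          ENNReal.ofReal (C * √(n : ℝ) / σ ^ 2)
              * (∫⁻ ω, (⨆ j, ‖NormalApprox.delta f (X ω) (X' ω) j‖ₑ) ^ 8 ∂P) ^ (1 / 4 : ℝ)
              * (∫⁻ ω, (NormalApprox.onePlusDegree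
                  (G' fun i : Fin (n + 4) => ξ i ω) 0 : ℝ≥0∞) ^ 4 ∂P) ^ (1 / 4 : ℝ)
            + ENNReal.ofReal (1 / (2 * σ ^ 3))
              * ∑ j, ∫⁻ ω, ‖NormalApprox.delta f (X ω) (X' ω) j‖ₑ ^ 3 ∂P := by
  refine ⟨1652, by norm_num, ?_⟩
  intro 𝒳 _ Ω _ P _ n hn f hf G _ hG G' hsymm hext hG' ξ hξ hindep hident X X' hX hX'm hcopy
    hcopyindep hW σ hσ hvar
  set μ := P.map (ξ 0) with hμ
  have hprob : IsProbabilityMeasure μ := Measure.isProbabilityMeasure_map (hξ 0).aemeasurable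
  have hlaw : ∀ k, MeasurePreserving (fun ω (i : Fin k) => ξ i ω) P
      (NormalApprox.iid μ (Fin k)) := by
    intro k
    refine ⟨measurable_pi_lambda _ fun i => hξ i, ?_⟩
    have h1 : iIndepFun (fun i : Fin k => ξ i) P := hindep.precomp Fin.val_injective
    rw [(iIndepFun_iff_map_fun_eq_pi_map (f := fun i : Fin k => ξ i)
      fun i => (hξ i).aemeasurable).1 h1]
    congr 1
    funext i
    exact (hident i).map_eq
  have hXeq : X = fun ω (i : Fin n) => ξ i ω := by
    funext ω i
    exact hX ω i
  have hXlaw : MeasurePreserving X P (NormalApprox.iid μ (Fin n)) := hXeq ▸ hlaw n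
  -- The terms in M and Δ_j depend only on the joint law of (X, X'), and the term in δ only on the
  -- law of the first n + 4 variables, so the claim moves to product measures.
  have hpair : MeasurePreserving (fun ω => (X ω, X' ω)) P (NormalApprox.iidPair μ n) := by
    refine ⟨hXlaw.measurable.prodMk hX'm, ?_⟩
    rw [(indepFun_iff_map_prod_eq_prod_map_map hXlaw.measurable.aemeasurable
      hX'm.aemeasurable).1 hcopyindep, hcopy.map_eq, hXlaw.map_eq]
  have hf2 : MemLp f 2 (NormalApprox.iid μ (Fin n)) := by
    rw [← hXlaw.map_eq]
    exact (memLp_map_measure_iff hf.aestronglyMeasurable hXlaw.measurable.aemeasurable).2 hW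
  have hmean : ∫ ω, f (X ω) ∂P = ∫ x, f x ∂NormalApprox.iid μ (Fin n) := by
    rw [← hXlaw.map_eq]
    exact (integral_map hXlaw.measurable.aemeasurable hf.aestronglyMeasurable).symm
  have hvar' : σ ^ 2 = variance f (NormalApprox.iid μ (Fin n)) := by
    rw [hvar, ← hXlaw.map_eq, variance_map hf.aemeasurable hXlaw.measurable.aemeasurable]
    rfl
  have hK : ∫⁻ ω, (⨆ j, ‖NormalApprox.delta f (X ω) (X' ω) j‖ₑ) ^ 8 ∂P
      = ∫⁻ p, NormalApprox.maxDelta f p ^ 8 ∂NormalApprox.iidPair μ n :=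
    hpair.lintegral_comp ((NormalApprox.measurable_maxDelta hf).pow_const 8)
  have hthird : ∀ j, ∫⁻ ω, ‖NormalApprox.delta f (X ω) (X' ω) j‖ₑ ^ 3 ∂P
      = ∫⁻ p, ‖NormalApprox.delta f p.1 p.2 j‖ₑ ^ 3 ∂NormalApprox.iidPair μ n := fun j =>
    hpair.lintegral_comp ((NormalApprox.measurable_pairDelta hf j).enorm.pow_const 3)
  have hD : ∫⁻ ω, (NormalApprox.onePlusDegree (G' fun i : Fin (n + 4) => ξ i ω) 0 : ℝ≥0∞) ^ 4 ∂P
      = ∫⁻ y, (NormalApprox.onePlusDegree (G' y) 0 : ℝ≥0∞) ^ 4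
        ∂NormalApprox.iid μ (Fin (n + 4)) :=
    (hlaw (n + 4)).lintegral_comp ((NormalApprox.measurable_onePlusDegree hG' 0).pow_const 4)
  rw [hK, hD, Finset.sum_congr rfl fun j _ => hthird j]
  refine iSup₂_le fun h hh => ?_
  have hmeas : Measurable fun x => (f x - ∫ y, f y ∂NormalApprox.iid μ (Fin n)) / σ :=
    (hf.sub_const _).div_const σ
  have e : ∫ t, h t ∂P.map (fun ω => (f (X ω) - ∫ y, f y ∂NormalApprox.iid μ (Fin n)) / σ)
      = ∫ x, h ((f x - ∫ y, f y ∂NormalApprox.iid μ (Fin n)) / σ) ∂NormalApprox.iid μ (Fin n) := by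
    have hWm : Measurable fun ω => (f (X ω) - ∫ y, f y ∂NormalApprox.iid μ (Fin n)) / σ :=
      hmeas.comp hXlaw.measurable
    have h1 := integral_map (μ := P) hXlaw.measurable.aemeasurable
      (hh.continuous.measurable.comp hmeas).aestronglyMeasurable
    rw [hXlaw.map_eq] at h1
    rw [integral_map hWm.aemeasurable hh.continuous.aestronglyMeasurable]
    exact h1.symm
  rw [hmean, ← hvar, Real.sqrt_sq hσ.le, e]
  exact NormalApprox.ofReal_abs_integral_sub_gaussian_le hsymm hext hG' hG hf hn hf2 hσ hvar' hh
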